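/- Let $\mathcal T\subset\mathbb R^n$ be a nonempty closed set with compact boundary, let $\mathbf d(x)=\operatorname{dist}(x,\mathcal T)$, and put $X:=\mathbb R^n\setminus\mathcal T$. Let $f_1,\dots,f_m$ be vector fields on $X$ such that, for every bounded open set $\Omega\subset\mathbb R^n$, each $f_i$ is bounded and Lipschitz continuous on $\Omega\setminus\mathcal T$. Let $A=\{\pm e_1,\dots,\pm e_m\}\subset\mathbb R^m$ and consider the control system $$\dot y=\sum_{i=1}^m a_i f_i(y),\qquad y(0)=x\in X,\qquad a\in A. \tag{1}$$ **Set-valued brackets and Hamiltonian.** Where $f,g$ are differentiable let $[f,g]=Dg\cdot f-Df\cdot g$. For $x\in X$ let $$[f_i,f_j]_{set}(x)=\operatorname{co}\Big\{v:\ v=\lim_k\,[f_i,f_j](x_k)\ \text{for some sequence } x_k\to x,\ x_k\in X \text{ points of differentiability of both } f_i \text{ and } f_j\Big\},$$ where $\operatorname{co}$ is the convex hull. Let $\mathcal F^{(2)}(x)$ be the family consisting of the sets $\{f_\ell(x)\}$, $\{-f_\ell(x)\}$ $(1\le\ell\le m)$ and $[f_i,f_j]_{set}(x)$ $(1\le i,j\le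 m)$, and let $$H^{(2)}(x,p)=\inf_{v\in\mathcal F^{(2)}(x)}\ \sup_{w\in v}\ \langle p,w\rangle ,\qquad (x,p)\in X\times\mathbb R^n .$$ **Degree-2 control Lyapunov function.** This is a continuous function $U:\overline{X}\to\mathbb R$ such that * for every compact $K\subset X$ there is $\rho>0$ with $U(z_1)+U(z_2)-2U\big(\tfrac{z_1+z_2}2\big)\le\rho|z_1-z_2|^2$ whenever $z_1,z_2\in K$ and the segment $[z_1,z_2]$ lies in $K$; * $U>0$ on $X$ and $U=0$ on $\partial\mathcal T$; * $U^{-1}(K)$ is compact for every compact $K\subset[0,\infty)$; * $H^{(2)}(x,p)<0$ for every $x\in X$ and every $p\in D^*U(x)$, where $D^*U(x)$ is the set of all limits $\lim_k\nabla U(x_k)$ along sequences $x_k\to x$, $x_k\ne x$, of points of $X$ at which $U$ is differentiable. **Global asymptotic controllability.** $\mathcal{KL}$ is the set of continuous $\beta:[0,\infty)^2\to[0,\infty)$ such that, for all $\delta,s\ge0$: $\beta(0,s)=0$; $\beta(\cdot,s)$ is strictly increasing and unbounded; $\beta(\delta,\cdot)$ is nonincreasing; and $\beta(\delta,r)\to0$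 as $r\to\infty$. System (1) is *globally asymptotically controllable (GAC) to $\mathcal T$* if there is $\beta\in\mathcal{KL}$ such that for each $x\in X$ there are a measurable control $\alpha:[0,\infty)\to A$, a time $S\in(0,+\infty]$ and a (Carathéodory) solution $y:[0,S)\to X$ of $\dot y=\sum_i\alpha_i f_i(y)$, $y(0)=x$, with $\lim_{t\to S^-}\mathbf d(y(t))=0$ and $$\mathbf d(y(t))\le\beta(\mathbf d(x),t)\qquad\text{for all } t\ge0,$$ where, if $S<+\infty$, $y$ is prolonged to $[S,\infty)$ by a constant $\bar x\in\partial\mathcal T$. **Theorem.** If a degree-2 control Lyapunov function exists, then system (1) is GAC to $\mathcal T$. -/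

import Mathlib

open Set Filter Topology

noncomputable section

namespace LieCLF

/-- The state space `ℝⁿ` with its Euclidean norm. -/
abbrev State (n : ℕ) : Type := EuclideanSpace ℝ (Fin n)

/-! ### Regularity of the vector fields and set-valued brackets -/

/-- The class `C_b^{0,1}(S)`: bounded, (globally) Lipschitz continuous vector fields on `S`. -/
def IsCb01On {n : ℕ} (g : State n → State n) (S : Set (State n)) : Prop :=
  (∃ M : ℝ, ∀ x ∈ S, ‖g x‖ ≤ M) ∧ ∃ K : NNReal, LipschitzOnWith K g S

/-- The limits of classical Lie brackets `[f,g](x_k) = Dg(x_k) f(x_k) - Df(x_k) g(x_k)` along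
sequences `x_k → x` in `Ω` at which both `f` and `g` are differentiable. -/
def limitBrackets {n : ℕ} (Ω : Set (State n)) (f g : State n → State n) (x : State n) :
    Set (State n) :=
  {v | ∃ u : ℕ → State n,
    (∀ k, u k ∈ Ω ∧ DifferentiableAt ℝ f (u k) ∧ DifferentiableAt ℝ g (u k)) ∧
    Tendsto u atTop (𝓝 x) ∧
    Tendsto (fun k => VectorField.lieBracket ℝ f g (u k)) atTop (𝓝 v)}

/-- The set-valued Lie bracket `[f,g]_set(x)`. -/
def setBracket {n : ℕ} (Ω : Set (State n)) (f g : State n → State n) (x : State n) :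
    Set (State n) :=
  convexHull ℝ (limitBrackets Ω f g x)

/-- `𝓕⁽¹⁾(x) = { {f_ℓ(x)}, {-f_ℓ(x)} : ℓ = 1, …, m }`, a family of subsets of `ℝⁿ`. -/
def family1 {n m : ℕ} (f : Fin m → State n → State n) (x : State n) : Set (Set (State n)) :=
  {v | ∃ l : Fin m, v = {f l x} ∨ v = {-f l x}}

/-- `𝓕⁽²⁾(x) = 𝓕⁽¹⁾(x) ∪ { [f_i,f_j]_set(x) : i, j = 1, …, m }`. -/
def family2 {n m : ℕ} (Ω : Set (State n)) (f : Fin m → State n → State n) (x : State n) :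
    Set (Set (State n)) :=
  family1 f x ∪ {v | ∃ i j : Fin m, v = setBracket Ω (f i) (f j) x}

/-- The degree-2 Hamiltonian `H⁽²⁾(x,p) = inf_{v ∈ 𝓕⁽²⁾(x)} sup_{w ∈ v} ⟨p,w⟩`.
For `f_1, …, f_m` locally Lipschitz on the open set `Ω ∋ x` the family `𝓕⁽²⁾(x)` is finite and its
members are nonempty and compact, so the infimum and the suprema are genuine ones as soon as
`m ≥ 1`. (For `m = 0` the value is `0`, so that `H⁽²⁾(x,p) < 0` fails, as it does for `inf ∅ = ∞`.)
-/
def hamiltonian2 {n m : ℕ} (Ω : Set (State n)) (f : Fin m → State n → State n)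
    (x p : State n) : ℝ :=
  sInf ((fun v : Set (State n) => sSup ((fun w => inner ℝ p w) '' v)) '' family2 Ω f x)

/-! ### Control Lyapunov functions -/

/-- `F` is semiconcave on `S`. -/
def SemiconcaveOn {n : ℕ} (F : State n → ℝ) (S : Set (State n)) : Prop :=
  ContinuousOn F S ∧ ∃ ρ : ℝ, 0 < ρ ∧ ∀ z₁ ∈ S, ∀ z₂ ∈ S, segment ℝ z₁ z₂ ⊆ S →
    F z₁ + F z₂ - 2 * F (midpoint ℝ z₁ z₂) ≤ ρ * ‖z₁ - z₂‖ ^ 2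

/-- `F` is locally semiconcave on `Ω`: semiconcave on every compact subset of `Ω`. -/
def LocallySemiconcaveOn {n : ℕ} (F : State n → ℝ) (Ω : Set (State n)) : Prop :=
  ∀ K : Set (State n), K ⊆ Ω → IsCompact K → SemiconcaveOn F K

/-- The set `D*F(x)` of limiting gradients at `x` of a function `F` on the open set `Ω`. -/
def limitingGradients {n : ℕ} (Ω : Set (State n)) (F : State n → ℝ) (x : State n) :
    Set (State n) :=
  {w | ∃ u : ℕ → State n,
    (∀ k, u k ∈ Ω ∧ DifferentiableAt ℝ F (u k) ∧ u k ≠ x) ∧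
    Tendsto u atTop (𝓝 x) ∧
    Tendsto (fun k => gradient F (u k)) atTop (𝓝 w)}

/-- `U` is a degree-2 control Lyapunov function for the fields `f` and the target `T`. Only the
values of `U` on `closure Tᶜ` and those of the `f i` on `Tᶜ` matter. -/
structure IsDegreeTwoCLF {n m : ℕ} (f : Fin m → State n → State n) (T : Set (State n))
    (U : State n → ℝ) : Prop where
  continuousOn : ContinuousOn U (closure Tᶜ)
  locallySemiconcave : LocallySemiconcaveOn U Tᶜ
  pos : ∀ x ∈ Tᶜ, 0 < U x
  zero : ∀ x ∈ frontier T, U x = 0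
  proper : ∀ K : Set ℝ, K ⊆ Ici 0 → IsCompact K → IsCompact (closure Tᶜ ∩ U ⁻¹' K)
  decrease : ∀ x ∈ Tᶜ, ∀ p ∈ limitingGradients Tᶜ U x, hamiltonian2 Tᶜ f x p < 0

/-! ### Trajectories and global asymptotic controllability -/

/-- The control set `A = {±e_1, …, ±e_m} ⊆ ℝᵐ`. -/
def controlSet (m : ℕ) : Set (Fin m → ℝ) :=
  {a | ∃ i : Fin m, a = Pi.single i 1 ∨ a = -Pi.single i 1}

/-- `y` is a (Carathéodory) solution on `[0,S)`, `0 < S ≤ +∞`, of `y' = ∑ i, α_i f_i(y)`, `y(0) = x`,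
with values in the domain `Tᶜ` of the vector fields. -/
structure IsSolution {n m : ℕ} (f : Fin m → State n → State n) (T : Set (State n))
    (x : State n) (y : ℝ → State n) (α : ℝ → Fin m → ℝ) (S : EReal) : Prop where
  pos : 0 < S
  init : y 0 = x
  continuousOn : ContinuousOn y {t : ℝ | 0 ≤ t ∧ (t : EReal) < S}
  mem : ∀ t : ℝ, 0 ≤ t → (t : EReal) < S → y t ∈ Tᶜ
  integrable : ∀ t : ℝ, 0 ≤ t → (t : EReal) < S →
    IntervalIntegrable (fun s => ∑ i, α s i • f i (y s)) MeasureTheory.volume 0 t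
  eq : ∀ t : ℝ, 0 ≤ t → (t : EReal) < S → y t = x + ∫ s in (0 : ℝ)..t, ∑ i, α s i • f i (y s)

/-- `(y,α)` is an admissible trajectory-control pair from `x`, defined up to `S ≤ +∞`: `α` is a
measurable control with values in `A`, `y` is a solution on `[0,S)`, and the distance of `y(t)` from
the target tends to `0` as `t → S`. -/
structure IsAdmissible {n m : ℕ} (f : Fin m → State n → State n) (T : Set (State n))
    (x : State n) (y : ℝ → State n) (α : ℝ → Fin m → ℝ) (S : EReal) : Prop where
  measurable : Measurable α
  control_mem : ∀ t : ℝ, 0 ≤ t → α t ∈ controlSet m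
  solution : IsSolution f T x y α S
  limit_of_top : S = ⊤ → Tendsto (fun t => Metric.infDist (y t) T) atTop (𝓝 0)
  limit_of_real : ∀ r : ℝ, S = r → Tendsto (fun t => Metric.infDist (y t) T) (𝓝[<] r) (𝓝 0)

/-- The class `KL` of comparison functions `β : [0,∞) × [0,∞) → [0,∞)`. -/
structure IsKL (β : ℝ → ℝ → ℝ) : Prop where
  continuousOn : ContinuousOn (Function.uncurry β) (Ici 0 ×ˢ Ici 0)
  nonneg : ∀ δ s : ℝ, 0 ≤ δ → 0 ≤ s → 0 ≤ β δ s
  zero : ∀ s : ℝ, 0 ≤ s → β 0 s = 0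
  strictMono : ∀ s : ℝ, 0 ≤ s → StrictMonoOn (fun δ => β δ s) (Ici 0)
  unbounded : ∀ s : ℝ, 0 ≤ s → ∀ M : ℝ, ∃ δ : ℝ, 0 ≤ δ ∧ M < β δ s
  antitone : ∀ δ : ℝ, 0 ≤ δ → AntitoneOn (fun s => β δ s) (Ici 0)
  tendsto : ∀ δ : ℝ, 0 ≤ δ → Tendsto (fun s => β δ s) atTop (𝓝 0)

/-- The system `y' = ∑ i, a_i f_i(y)`, `a ∈ A`, is globally asymptotically controllable to `T`.
If `S < +∞`, the trajectory is prolonged to `[S,∞)` by a constant `x̄ ∈ ∂T`. -/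
def IsGAC {n m : ℕ} (f : Fin m → State n → State n) (T : Set (State n)) : Prop :=
  ∃ β : ℝ → ℝ → ℝ, IsKL β ∧ ∀ x ∈ Tᶜ,
    ∃ (y : ℝ → State n) (α : ℝ → Fin m → ℝ) (S : EReal),
      IsAdmissible f T x y α S ∧
      (∃ xbar ∈ frontier T, ∀ t : ℝ, S ≤ (t : EReal) → y t = xbar) ∧
      ∀ t : ℝ, 0 ≤ t → Metric.infDist (y t) T ≤ β (Metric.infDist x T) t

end LieCLF

end

/-! A descent argument carried out one point at a time. A limiting gradient `p` of the semiconcave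
`U` at `x₀` is a proximal supergradient: `U (x₀ + h) ≤ U x₀ + ⟨p, h⟩ + 2ρ‖h‖²` for small `h`.
Negativity of the Hamiltonian at `p` leaves two cases. If `⟨p, ±f_l x₀⟩ < 0`, flowing along that
field for a short time `t` lowers `U` at order `t`. If `⟨p, ·⟩` is bounded by a negative `c` on the
limiting brackets of `f_i, f_j`, run the commutator word `f_i, f_j, -f_i, -f_j`, each for time `t`.
Its displacement is `O(t²)`, so the quadratic error is `O(t⁴)`, and it remains to show that `⟨p,
displacement⟩ ≤ (c/8) t²`.

This last estimate is the delicate one, since the fields are only Lipschitz and brackets exist only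
almost everywhere. Up to `O(t³)` the displacement is the circulation of the fields along a
parallelogram (`norm_commutator_sub_le`). Green's formula bounds the circulation by the area times
an almost everywhere bound on the curl; it is proved for almost every translate of the parallelogram
by Fubini, then for all by continuity (`circulation_le`). The curl is the bracket paired with `p`,
up to a small error, and compactness bounds it near `x₀`.

The word found at `x₀` depends continuously on its starting point, hence works nearby with a uniform
decrease. Properness of `U` makes shells `a ≤ U ≤ b` compact, so `U` can be halved there in bounded
time with overshoot at most a factor 2 (`exists_halving`). Iterating the halving and gluing gives a
trajectory on which `U → 0`. Properness of `U` and compactness of the boundary translate between `U`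
and the distance, giving uniform stability, boundedness and attractivity, from which a `KL` bound is
manufactured (`exists_isKL_of_uniform`). -/

namespace LieCLF

/-! ### Comparison functions: from uniform estimates to a `KL` bound -/

/-- A monotone function vanishing on `(-∞,0]` and infinitesimal at `0⁺` is dominated by a
continuous, strictly increasing and unbounded function vanishing at `0`. -/
theorem exists_continuous_majorant (g : ℝ → ℝ) (hmono : Monotone g)
    (hneg : ∀ x ≤ 0, g x = 0) (hsmall : ∀ ε > 0, ∃ δ > 0, g δ ≤ ε) :
    ∃ G : ℝ → ℝ, ContinuousOn G (Ici 0) ∧ G 0 = 0 ∧ StrictMonoOn G (Ici 0) ∧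
      (∀ x, 0 ≤ x → g x ≤ G x) ∧ ∀ x, 0 ≤ x → x ≤ G x := by
  have hnn : ∀ x, 0 ≤ g x := fun x => by
    rcases le_total x 0 with h | h
    · rw [hneg x h]
    · rw [← hneg 0 le_rfl]; exact hmono h
  have hint : ∀ x, 0 ≤ x → IntervalIntegrable (fun r => g (x * r)) MeasureTheory.volume 1 2 := by
    intro x hx
    exact (hmono.comp (monotone_id.const_mul hx)).intervalIntegrable
  have hle : ∀ x, 0 ≤ x → ∫ r in (1:ℝ)..2, g (x * r) ≤ g (2 * x) := by
    intro x hx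
    have h := intervalIntegral.integral_mono_on (by norm_num : (1:ℝ) ≤ 2) (hint x hx)
      (intervalIntegrable_const (c := g (2 * x)))
      (fun r hr => hmono (by nlinarith [hr.2]))
    refine h.trans_eq ?_
    simp; norm_num
  have hge : ∀ x, 0 ≤ x → g x ≤ ∫ r in (1:ℝ)..2, g (x * r) := by
    intro x hx
    have h := intervalIntegral.integral_mono_on (by norm_num : (1:ℝ) ≤ 2)
      (intervalIntegrable_const (c := g x)) (hint x hx)
      (fun r hr => hmono (by nlinarith [hr.1]))
    refine le_trans (le_of_eq ?_) h
    simp; norm_num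
  -- The integral is the mean of `g` over `[x, 2x]`: it lies between `g x` and `g (2x)`, and for `x
  -- > 0` it is continuous as a difference of primitives divided by `x`. The summand `x` adds
  -- strictness and unboundedness.
  refine ⟨fun x => x + ∫ r in (1:ℝ)..2, g (x * r), ?_, by simp [hneg 0 le_rfl], ?_, ?_, ?_⟩
  · intro x hx
    rcases eq_or_lt_of_le (show (0:ℝ) ≤ x from hx) with rfl | hx
    · refine continuousWithinAt_id.add ?_
      rw [ContinuousWithinAt, Metric.tendsto_nhdsWithin_nhds]
      intro ε hε
      obtain ⟨δ, hδ, h⟩ := hsmall (ε / 2) (by positivity)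
      refine ⟨δ / 2, by positivity, fun {x} hx hd => ?_⟩
      have hx0 : (0:ℝ) ≤ x := hx
      rw [Real.dist_eq, sub_zero, abs_of_nonneg hx0] at hd
      have h1 := hle x hx0
      have h2 : g (2 * x) ≤ g δ := hmono (by linarith)
      have h3 := hge x hx0
      have h4 := hnn x
      simp only [Real.dist_eq, zero_mul, hneg 0 le_rfl, intervalIntegral.integral_zero, sub_zero]
      rw [abs_of_nonneg (by linarith)]
      linarith
    · refine ContinuousAt.continuousWithinAt ?_
      refine continuousAt_id.add ?_
      have hP : Continuous fun u : ℝ => ∫ r in (0:ℝ)..u, g r :=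
        intervalIntegral.continuous_primitive (fun a b => hmono.intervalIntegrable) 0
      have : (fun x : ℝ => ∫ r in (1:ℝ)..2, g (x * r)) =ᶠ[𝓝 x]
          fun x => x⁻¹ * ((∫ r in (0:ℝ)..(x * 2), g r) - ∫ r in (0:ℝ)..(x * 1), g r) := by
        filter_upwards [lt_mem_nhds hx] with z hz
        rw [intervalIntegral.integral_interval_sub_left hmono.intervalIntegrable
          hmono.intervalIntegrable, ← intervalIntegral.mul_integral_comp_mul_left]
        field_simp
      rw [continuousAt_congr this]
      refine (continuousAt_inv₀ hx.ne').mul (ContinuousAt.sub ?_ ?_)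
      · exact (hP.comp (continuous_id.mul continuous_const)).continuousAt
      · exact (hP.comp (continuous_id.mul continuous_const)).continuousAt
  · intro x hx z hz hxz
    have hx0 : (0:ℝ) ≤ x := hx
    have h := intervalIntegral.integral_mono_on (by norm_num : (1:ℝ) ≤ 2) (hint x hx) (hint z hz)
      (fun r hr => hmono (by nlinarith [hr.1]))
    exact add_lt_add_of_lt_of_le hxz h
  · intro x hx
    have := hge x hx
    simp only; linarith
  · intro x hx
    have := hge x hx
    have := hnn x
    simp only; linarith

/-- A nonincreasing function tending to `0` is dominated on `[0,∞)` by a continuous one which is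
positive. -/
theorem exists_continuous_majorant_atTop (ψ : ℝ → ℝ) (hanti : Antitone ψ)
    (hlim : Tendsto ψ atTop (𝓝 0)) :
    ∃ Ψ : ℝ → ℝ, ContinuousOn Ψ (Ici 0) ∧ (∀ t, 0 ≤ t → 0 < Ψ t) ∧ AntitoneOn Ψ (Ici 0) ∧
      Tendsto Ψ atTop (𝓝 0) ∧ ∀ t, 0 ≤ t → ψ t ≤ Ψ t := by
  have hnn : ∀ t, 0 ≤ ψ t := fun t => hanti.le_of_tendsto hlim t
  -- The substitution `u = 1 / (1 + t)` turns decay at infinity into smallness at `0⁺`.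
  obtain ⟨H, hc, h0, hs, hmaj, -⟩ := exists_continuous_majorant
    (fun u => if u ≤ 0 then 0 else ψ (u⁻¹ - 1)) (by
      intro u v huv
      by_cases hu : u ≤ 0
      · by_cases hv : v ≤ 0
        · simp [hu, hv]
        · simp [hu, hv, hnn]
      · have hv : ¬ v ≤ 0 := by linarith
        simp only [hu, hv, if_false]
        apply hanti
        have := inv_anti₀ (not_le.1 hu) huv
        linarith) (by intro x hx; simp [hx]) (by
      intro ε hε
      obtain ⟨N, hN⟩ := ((tendsto_order.1 hlim).2 ε hε).exists_forall_of_atTop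
      have hp : 0 < |N| + 1 := by positivity
      refine ⟨(|N| + 1)⁻¹, by positivity, ?_⟩
      rw [if_neg (by push Not; positivity), inv_inv]
      exact (hN _ (by linarith [le_abs_self N])).le)
  have hmaps : ∀ t : ℝ, 0 ≤ t → 0 < (1 + t)⁻¹ := fun t ht => by positivity
  refine ⟨fun t => H (1 + t)⁻¹, ?_, ?_, ?_, ?_, ?_⟩
  · refine hc.comp (ContinuousOn.inv₀ (by fun_prop) ?_) (fun t ht => (hmaps t ht).le)
    intro t ht
    have : (0:ℝ) ≤ t := ht
    positivity
  · intro t ht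
    rw [← h0]
    exact hs (by simp) (hmaps t ht).le (hmaps t ht)
  · intro s hs' t ht hst
    have hs0 : (0:ℝ) ≤ s := hs'
    exact hs.monotoneOn (hmaps t ht).le (hmaps s hs').le (inv_anti₀ (by positivity) (by linarith))
  · have h1 : Tendsto (fun t : ℝ => (1 + t)⁻¹) atTop (𝓝[≥] 0) := by
      refine tendsto_nhdsWithin_iff.2 ⟨?_, ?_⟩
      · exact tendsto_inv_atTop_zero.comp (tendsto_atTop_add_const_left _ _ tendsto_id)
      · filter_upwards [eventually_ge_atTop 0] with t ht using (hmaps t ht).le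
    have h2 := (hc 0 (by simp)).tendsto
    rw [h0] at h2
    exact h2.comp h1
  · intro t ht
    have := hmaj _ (hmaps t ht).le
    simp only [not_le.2 (hmaps t ht), if_false, inv_inv] at this
    simpa using this

/-- Countably many nonincreasing functions tending to `0` are dominated, up to constants, by a
single one. -/
theorem exists_common_majorant (ψ : ℕ → ℝ → ℝ) (hanti : ∀ k, Antitone (ψ k))
    (hlim : ∀ k, Tendsto (ψ k) atTop (𝓝 0)) (hbd : ∀ k t, ψ k t ≤ ψ k 0) :
    ∃ (Ψ : ℝ → ℝ) (c : ℕ → ℝ), Antitone Ψ ∧ Tendsto Ψ atTop (𝓝 0) ∧ (∀ k, 0 < c k) ∧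
      ∀ k t, ψ k t ≤ c k * Ψ t := by
  have hnn : ∀ k t, 0 ≤ ψ k t := fun k t => (hanti k).le_of_tendsto (hlim k) t
  have hm : ∀ k, 0 < ψ k 0 + 1 := fun k => by linarith [hnn k 0]
  have hterm : ∀ k t, 0 ≤ (1 / 2 : ℝ) ^ k * (ψ k t / (ψ k 0 + 1)) := fun k t =>
    mul_nonneg (by positivity) (div_nonneg (hnn k t) (hm k).le)
  have hterm' : ∀ k t, (1 / 2 : ℝ) ^ k * (ψ k t / (ψ k 0 + 1)) ≤ (1 / 2 : ℝ) ^ k := fun k t =>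
    mul_le_of_le_one_right (by positivity) ((div_le_one (hm k)).2 (by linarith [hbd k t]))
  have hgeo : Summable fun k : ℕ => (1 / 2 : ℝ) ^ k := summable_geometric_two
  have hsum : ∀ t, Summable fun k => (1 / 2 : ℝ) ^ k * (ψ k t / (ψ k 0 + 1)) := fun t =>
    Summable.of_nonneg_of_le (fun k => hterm k t) (fun k => hterm' k t) hgeo
  -- After normalisation the `k`-th term is at most `2⁻ᵏ` for every `t`, so dominated convergence
  -- passes the limit through the sum.
  refine ⟨fun t => ∑' k, (1 / 2 : ℝ) ^ k * (ψ k t / (ψ k 0 + 1)),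
    fun k => 2 ^ k * (ψ k 0 + 1), ?_, ?_, fun k => mul_pos (by positivity) (hm k), ?_⟩
  · intro s t hst
    refine (hsum t).tsum_le_tsum (fun k => ?_) (hsum s)
    have := hanti k hst
    have := hm k
    gcongr
  · have := tendsto_tsum_of_dominated_convergence (𝓕 := atTop)
      (f := fun (t : ℝ) k => (1 / 2 : ℝ) ^ k * (ψ k t / (ψ k 0 + 1))) (g := fun _ => (0:ℝ)) hgeo
      (fun k => by simpa using ((hlim k).div_const (ψ k 0 + 1)).const_mul ((1 / 2 : ℝ) ^ k))
      (Eventually.of_forall fun t k => by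
        rw [Real.norm_of_nonneg (hterm k t)]; exact hterm' k t)
    simpa using this
  · intro k t
    have h := (hsum t).le_tsum k (fun j _ => hterm j t)
    have h2 : ψ k t = 2 ^ k * (ψ k 0 + 1) * ((1 / 2 : ℝ) ^ k * (ψ k t / (ψ k 0 + 1))) := by
      have := (hm k).ne'
      field_simp
      rw [mul_assoc, ← mul_pow]; norm_num
    exact h2.le.trans (mul_le_mul_of_nonneg_left h (mul_pos (by positivity) (hm k)).le)

/-- Uniform stability, uniform boundedness and uniform attractivity of a family of functions give
a `KL` bound. -/
theorem exists_isKL_of_uniform {ι : Type*} (r : ι → ℝ) (D : ι → ℝ → ℝ) (hr : ∀ i, 0 < r i)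
    (hD : ∀ i t, 0 ≤ t → 0 ≤ D i t)
    (stable : ∀ ε > 0, ∃ δ > 0, ∀ i, r i ≤ δ → ∀ t, 0 ≤ t → D i t ≤ ε)
    (bounded : ∀ R, ∃ M, ∀ i, r i ≤ R → ∀ t, 0 ≤ t → D i t ≤ M)
    (attractive : ∀ R, ∀ ε > 0, ∃ T, ∀ i, r i ≤ R → ∀ t, 0 ≤ t → T ≤ t → D i t ≤ ε) :
    ∃ β, IsKL β ∧ ∀ i t, 0 ≤ t → D i t ≤ β (r i) t := by
  -- The value `0` is included so that the supremum `ω δ t` is over a nonempty set and nonnegative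
  -- even when no index has `r i ≤ δ`.
  let A : ℝ → ℝ → Set ℝ := fun δ t =>
    {v | v = 0 ∨ ∃ i s, r i ≤ δ ∧ 0 ≤ s ∧ t ≤ s ∧ v = D i s}
  have hA0 : ∀ δ t, (0:ℝ) ∈ A δ t := fun δ t => Or.inl rfl
  have hAb : ∀ δ t, BddAbove (A δ t) := by
    intro δ t
    obtain ⟨M, hM⟩ := bounded δ
    refine ⟨max M 0, ?_⟩
    rintro v (rfl | ⟨i, s, h1, h2, -, rfl⟩)
    · exact le_max_right _ _
    · exact (hM i h1 s h2).trans (le_max_left _ _)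
  let ω : ℝ → ℝ → ℝ := fun δ t => sSup (A δ t)
  have hω0 : ∀ δ t, 0 ≤ ω δ t := fun δ t => le_csSup (hAb δ t) (hA0 δ t)
  have hωle : ∀ δ t ε, 0 ≤ ε → (∀ i, r i ≤ δ → ∀ s, 0 ≤ s → t ≤ s → D i s ≤ ε) → ω δ t ≤ ε := by
    intro δ t ε hε h
    refine csSup_le ⟨0, hA0 δ t⟩ ?_
    rintro v (rfl | ⟨i, s, h1, h2, h3, rfl⟩)
    · exact hε
    · exact h i h1 s h2 h3
  have hDω : ∀ δ i t, r i ≤ δ → 0 ≤ t → D i t ≤ ω δ t := fun δ i t h1 h2 =>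
    le_csSup (hAb δ t) (Or.inr ⟨i, t, h1, h2, le_rfl, rfl⟩)
  have hωmono : ∀ t, Monotone fun δ => ω δ t := by
    intro t δ δ' h
    refine csSup_le_csSup (hAb _ _) ⟨0, hA0 _ _⟩ ?_
    rintro v (rfl | ⟨i, s, h1, h2, h3, rfl⟩)
    · exact hA0 _ _
    · exact Or.inr ⟨i, s, h1.trans h, h2, h3, rfl⟩
  have hωanti : ∀ δ, Antitone (ω δ) := by
    intro δ t t' h
    refine csSup_le_csSup (hAb _ _) ⟨0, hA0 _ _⟩ ?_
    rintro v (rfl | ⟨i, s, h1, h2, h3, rfl⟩)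
    · exact hA0 _ _
    · exact Or.inr ⟨i, s, h1, h2, h.trans h3, rfl⟩
  have hωneg : ∀ δ t, δ ≤ 0 → ω δ t = 0 := fun δ t hδ =>
    le_antisymm (hωle δ t 0 le_rfl fun i hi => absurd (hr i) (by linarith)) (hω0 δ t)
  -- Integer radii suffice, since `ω` is monotone in `δ`; this reduces to countably many decay
  -- profiles and separates the variables.
  obtain ⟨ψ, c, hψa, hψl, hc, hψ⟩ := exists_common_majorant (fun k t => ω k t)
    (fun k => hωanti k) (by
      intro k
      rw [Metric.tendsto_atTop]
      intro ε hε
      obtain ⟨T, hT⟩ := attractive k (ε / 2) (by positivity)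
      refine ⟨T, fun t ht => ?_⟩
      rw [Real.dist_eq, sub_zero, abs_of_nonneg (hω0 _ _)]
      have := hωle k t (ε / 2) (by positivity) (fun i hi s h0 hs => hT i hi s h0 (ht.trans hs))
      linarith) (by
      intro k t
      exact hωle k t _ (hω0 _ _) (fun i hi s h0 _ => (hDω k i s hi h0).trans (hωanti k h0)))
  obtain ⟨Ψ, hΨc, hΨp, hΨa, hΨl, hΨ⟩ := exists_continuous_majorant_atTop ψ hψa hψl
  let C : ℝ → ℝ := fun δ => ∑ k ∈ Finset.range (⌈δ⌉₊ + 1), c k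
  have hC0 : ∀ δ, 0 ≤ C δ := fun δ => Finset.sum_nonneg fun k _ => (hc k).le
  have hCmono : Monotone C := by
    intro δ δ' h
    refine Finset.sum_le_sum_of_subset_of_nonneg ?_ fun k _ _ => (hc k).le
    have := Nat.ceil_mono h
    exact Finset.range_mono (by omega)
  obtain ⟨G, hGc, hG0, hGs, hG, hGid⟩ := exists_continuous_majorant (fun δ => ω δ 0 * C δ)
    (fun δ δ' h => mul_le_mul (hωmono 0 h) (hCmono h) (hC0 _) (hω0 _ _))
    (fun δ hδ => by simp [hωneg δ 0 hδ]) (by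
      intro ε hε
      have hC1 : 0 < C 1 + 1 := by linarith [hC0 1]
      obtain ⟨δ, hδ, h⟩ := stable (ε / (C 1 + 1)) (by positivity)
      refine ⟨min δ 1, by positivity, ?_⟩
      have h1 : ω (min δ 1) 0 ≤ ε / (C 1 + 1) :=
        hωle _ _ _ (by positivity) fun i hi s h0 _ => h i (hi.trans (min_le_left _ _)) s h0
      calc ω (min δ 1) 0 * C (min δ 1) ≤ ε / (C 1 + 1) * (C 1 + 1) :=
            mul_le_mul h1 ((hCmono (min_le_right _ _)).trans (by linarith)) (hC0 _) (by positivity)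
        _ = ε := by field_simp)
  have hGnn : ∀ δ, 0 ≤ δ → 0 ≤ G δ := fun δ hδ => hδ.trans (hGid δ hδ)
  -- Write `D² = D · D`: one factor is bounded by `ω δ 0`, small for small `δ` by stability, the
  -- other by `C δ * Ψ t`, which decays by attractivity. Neither bound alone has both properties.
  refine ⟨fun δ t => √(G δ * Ψ t), ⟨?_, ?_, ?_, ?_, ?_, ?_, ?_⟩, ?_⟩
  · refine ContinuousOn.sqrt (ContinuousOn.mul ?_ ?_)
    · exact hGc.comp continuousOn_fst (fun p hp => hp.1)
    · exact hΨc.comp continuousOn_snd (fun p hp => hp.2)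
  · intro δ s _ _; positivity
  · intro s _; simp [hG0]
  · intro s hs x hx z hz hxz
    have := hΨp s hs
    exact Real.sqrt_lt_sqrt (mul_nonneg (hGnn x hx) this.le)
      (mul_lt_mul_of_pos_right (hGs hx hz hxz) this)
  · intro s hs M
    have hp := hΨp s hs
    refine ⟨(|M| + 1) ^ 2 / Ψ s, by positivity, ?_⟩
    refine Real.lt_sqrt_of_sq_lt ?_ |>.trans_le' (le_abs_self M)
    calc |M| ^ 2 < (|M| + 1) ^ 2 := by nlinarith [abs_nonneg M]
      _ = (|M| + 1) ^ 2 / Ψ s * Ψ s := by field_simp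
      _ ≤ _ := mul_le_mul_of_nonneg_right (hGid _ (by positivity)) hp.le
  · intro δ hδ s hs t ht hst
    exact Real.sqrt_le_sqrt (mul_le_mul_of_nonneg_left (hΨa hs ht hst) (hGnn δ hδ))
  · intro δ hδ
    have := (hΨl.const_mul (G δ)).sqrt
    simpa using this
  · intro i t ht
    refine Real.le_sqrt_of_sq_le ?_
    have h1 := hDω (r i) i t le_rfl ht
    have h2 : D i t ≤ C (r i) * Ψ t := by
      have hk : r i ≤ (⌈r i⌉₊ : ℝ) := Nat.le_ceil _
      calc D i t ≤ ω (⌈r i⌉₊ : ℝ) t := hDω _ i t hk ht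
        _ ≤ c ⌈r i⌉₊ * ψ t := hψ _ t
        _ ≤ c ⌈r i⌉₊ * Ψ t := mul_le_mul_of_nonneg_left (hΨ t ht) (hc _).le
        _ ≤ C (r i) * Ψ t := mul_le_mul_of_nonneg_right
            (Finset.single_le_sum (f := c) (fun k _ => (hc k).le) (by simp)) (hΨp t ht).le
    calc D i t ^ 2 = D i t * D i t := sq _
      _ ≤ ω (r i) 0 * (C (r i) * Ψ t) :=
          mul_le_mul (h1.trans (hωanti _ ht)) h2 (hD i t ht) (hω0 _ _)
      _ = (ω (r i) 0 * C (r i)) * Ψ t := by ring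
      _ ≤ G (r i) * Ψ t := mul_le_mul_of_nonneg_right (hG _ (hr i).le) (hΨp t ht).le

end LieCLF

/-! ### Concatenation of controlled trajectories -/

namespace LieCLF

variable {n m : ℕ}

/-- `x` can be steered to `z` in time `τ` inside `V` by a measurable control with values in
`{±e_1, …, ±e_m}`. -/
def Steers (f : Fin m → State n → State n) (V : Set (State n)) (x z : State n) (τ : ℝ) : Prop :=
  ∃ (y : ℝ → State n) (α : ℝ → Fin m → ℝ), y 0 = x ∧ y τ = z ∧ ContinuousOn y (Icc 0 τ) ∧
    (∀ t ∈ Icc 0 τ, y t ∈ V) ∧ Measurable α ∧ (∀ t, α t ∈ controlSet m) ∧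
    ∀ t ∈ Ico 0 τ, HasDerivWithinAt y (∑ i, α t i • f i (y t)) (Ici t) t

theorem Steers.mono {f : Fin m → State n → State n} {V W : Set (State n)} {x z : State n} {τ : ℝ}
    (h : Steers f V x z τ) (hVW : V ⊆ W) : Steers f W x z τ := by
  obtain ⟨y, α, h0, h1, hc, hV, hr⟩ := h
  exact ⟨y, α, h0, h1, hc, fun t ht => hVW (hV t ht), hr⟩

theorem Steers.end_mem {f : Fin m → State n → State n} {V : Set (State n)} {x z : State n} {τ : ℝ}
    (h : Steers f V x z τ) (hτ : 0 ≤ τ) : z ∈ V := by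
  obtain ⟨y, α, -, rfl, -, hV, -⟩ := h
  exact hV τ ⟨hτ, le_rfl⟩

/-- The right derivative of a shifted curve. -/
theorem hasDerivWithinAt_shift {y : ℝ → State n} {v : State n} {s t : ℝ}
    (h : HasDerivWithinAt y v (Ici (t - s)) (t - s)) :
    HasDerivWithinAt (fun r => y (r - s)) v (Ici t) t := by
  have h1 : HasDerivWithinAt (fun r : ℝ => r - s) 1 (Ici t) t :=
    (hasDerivWithinAt_id t _).sub_const s
  have := HasDerivWithinAt.scomp (h := fun r : ℝ => r - s) (g₁ := y) t h h1 (fun r hr => by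
    simp only [mem_Ici] at *; linarith)
  rw [one_smul] at this
  exact this

theorem continuousOn_shift {y : ℝ → State n} {s τ : ℝ} (h : ContinuousOn y (Icc 0 τ)) :
    ContinuousOn (fun r => y (r - s)) (Icc s (s + τ)) :=
  h.comp (by fun_prop) fun r hr => ⟨by linarith [hr.1], by linarith [hr.2]⟩

/-- Asking only for right derivatives is what makes gluing painless: at the junction only the second
curve is seen. -/
theorem Steers.trans {f : Fin m → State n → State n} {V : Set (State n)} {x z w : State n}
    {τ σ : ℝ} (hτ : 0 ≤ τ) (hσ : 0 ≤ σ) (h1 : Steers f V x z τ) (h2 : Steers f V z w σ) :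
    Steers f V x w (τ + σ) := by
  obtain ⟨y, α, hy0, hyτ, hyc, hyV, hαm, hαA, hyd⟩ := h1
  obtain ⟨u, γ, hu0, huσ, huc, huV, hγm, hγA, hud⟩ := h2
  have hl : ∀ t ≤ τ, (if t < τ then y t else u (t - τ)) = y t := by
    intro t ht
    rcases ht.lt_or_eq with h | rfl
    · simp [h]
    · simp [hu0, hyτ]
  have hg : ∀ t, τ ≤ t → (if t < τ then y t else u (t - τ)) = u (t - τ) := by
    intro t ht
    simp [not_lt.2 ht]
  refine ⟨fun t => if t < τ then y t else u (t - τ), fun t => if t < τ then α t else γ (t - τ),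
    ?_, ?_, ?_, ?_, ?_, ?_, ?_⟩
  · exact (hl 0 hτ).trans hy0
  · simp only [hg (τ + σ) (by linarith)]
    simpa using huσ
  · rw [← Icc_union_Icc_eq_Icc hτ (by linarith : τ ≤ τ + σ)]
    refine ContinuousOn.union_of_isClosed ?_ ?_ isClosed_Icc isClosed_Icc
    · exact hyc.congr fun t ht => hl t ht.2
    · exact (continuousOn_shift huc).congr fun t ht => hg t ht.1
  · intro t ht
    rcases le_total t τ with h | h
    · simp only [hl t h]; exact hyV t ⟨ht.1, h⟩
    · simp only [hg t h]; exact huV _ ⟨by linarith, by linarith [ht.2]⟩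
  · exact Measurable.ite measurableSet_Iio hαm (hγm.comp (measurable_id.sub_const τ))
  · intro t
    dsimp only
    split_ifs
    exacts [hαA t, hγA _]
  · intro t ht
    rcases lt_or_ge t τ with h | h
    · simp only [h, if_true]
      refine (hyd t ⟨ht.1, h⟩).congr_of_eventuallyEq ?_ (hl t h.le)
      filter_upwards [mem_nhdsWithin_of_mem_nhds (Iio_mem_nhds h)] with r hr using hl r hr.le
    · simp only [not_lt.2 h, if_false]
      refine (hasDerivWithinAt_shift (hud (t - τ) ⟨by linarith, by linarith [ht.2]⟩)).congr
        (fun r hr => hg r (h.trans hr)) (hg t h)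

/-- Gluing an infinite sequence of trajectories; after the total time the curve is constant. -/
theorem exists_glue {f : Fin m → State n → State n} (V : ℕ → Set (State n)) (x : ℕ → State n)
    (τ : ℕ → ℝ) (hτ : ∀ k, 0 < τ k) (h : ∀ k, Steers f (V k) (x k) (x (k + 1)) (τ k))
    (xbar : State n) :
    ∃ (y : ℝ → State n) (α : ℝ → Fin m → ℝ), y 0 = x 0 ∧ Measurable α ∧
      (∀ t, α t ∈ controlSet m) ∧
      (∀ t, (∀ k, ∑ j ∈ Finset.range k, τ j ≤ t) → y t = xbar) ∧
      (∀ k, ContinuousOn y (Icc 0 (∑ j ∈ Finset.range k, τ j))) ∧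
      ∀ k t, ∑ j ∈ Finset.range k, τ j ≤ t → t < ∑ j ∈ Finset.range (k + 1), τ j →
        y t ∈ V k ∧ HasDerivWithinAt y (∑ i, α t i • f i (y t)) (Ici t) t := by
  classical
  choose Y A hY0 hYτ hYc hYV hAm hAA hYd using h
  set s : ℕ → ℝ := fun k => ∑ j ∈ Finset.range k, τ j with hs
  have hs0 : s 0 = 0 := by simp [hs]
  have hss : ∀ k, s (k + 1) = s k + τ k := fun k => Finset.sum_range_succ _ _
  have hsm : StrictMono s := strictMono_nat_of_lt_succ fun k => by rw [hss]; linarith [hτ k]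
  -- The second alternative makes `Nat.find` total: past the total time the index is `0`, which
  -- keeps the control measurable and admissible for all times.
  let p : ℕ → ℝ → Prop := fun k t => t < s (k + 1) ∨ ∀ j, s j ≤ t
  have hp : ∀ t, ∃ k, p k t := by
    intro t
    by_cases ht : ∀ j, s j ≤ t
    · exact ⟨0, Or.inr ht⟩
    · push Not at ht
      obtain ⟨j, hj⟩ := ht
      exact ⟨j, Or.inl (hj.trans (hsm j.lt_succ_self))⟩
  have hfind : ∀ k t, s k ≤ t → t < s (k + 1) → Nat.find (hp t) = k := by
    intro k t h1 h2
    rw [Nat.find_eq_iff]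
    refine ⟨Or.inl h2, fun j hj hpj => ?_⟩
    rcases hpj with hpj | hpj
    · exact absurd (hsm.monotone (Nat.succ_le_of_lt hj)) (not_le.2 (hpj.trans_le' h1))
    · exact absurd (hpj (k + 1)) (not_le.2 h2)
  let y : ℝ → State n := fun t =>
    if ∀ j, s j ≤ t then xbar else Y (Nat.find (hp t)) (t - s (Nat.find (hp t)))
  let α : ℝ → Fin m → ℝ := fun t => A (Nat.find (hp t)) (t - s (Nat.find (hp t)))
  have hy : ∀ k t, s k ≤ t → t < s (k + 1) → y t = Y k (t - s k) := by
    intro k t h1 h2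
    have : ¬ ∀ j, s j ≤ t := fun hh => absurd (hh (k + 1)) (not_le.2 h2)
    simp only [y, this, if_false, hfind k t h1 h2]
  have hy' : ∀ k t, s k ≤ t → t ≤ s (k + 1) → y t = Y k (t - s k) := by
    intro k t h1 h2
    rcases h2.lt_or_eq with h2 | rfl
    · exact hy k t h1 h2
    · rw [hy (k + 1) _ le_rfl (hsm (k + 1).lt_succ_self), sub_self, hY0, hss, add_sub_cancel_left,
        hYτ]
  refine ⟨y, α, ?_, ?_, fun t => hAA _ _, ?_, ?_, ?_⟩
  · rw [hy 0 0 hs0.le (by rw [hss, hs0]; linarith [hτ 0]), hs0, sub_zero, hY0]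
  · have hset : ∀ k, MeasurableSet {t | p k t} := fun k => by
      have : {t | p k t} = Iio (s (k + 1)) ∪ ⋂ j, Ici (s j) := by
        ext t; simp [p]
      rw [this]
      exact measurableSet_Iio.union (MeasurableSet.iInter fun j => measurableSet_Ici)
    exact Measurable.find (f := fun k t => A k (t - s k))
      (fun k => (hAm k).comp (measurable_id.sub_const _)) hset hp
  · intro t ht
    exact if_pos ht
  · intro k
    induction k with
    | zero => simp
    | succ k ih =>
      change ContinuousOn y (Icc 0 (s (k + 1)))
      rw [← Icc_union_Icc_eq_Icc (by rw [← hs0]; exact hsm.monotone k.zero_le : 0 ≤ s k)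
        (hsm k.lt_succ_self).le]
      refine ContinuousOn.union_of_isClosed ih ?_ isClosed_Icc isClosed_Icc
      rw [hss]
      exact (continuousOn_shift (hYc k)).congr fun t ht => hy' k t ht.1 (by rw [hss]; exact ht.2)
  · intro k t h1 h2
    have h3 : t - s k < τ k := by
      have := hss k
      change t < s (k + 1) at h2
      linarith
    have h1' : s k ≤ t := h1
    have h2' : t < s (k + 1) := h2
    refine ⟨?_, ?_⟩
    · rw [hy k t h1 h2]
      exact hYV k _ ⟨by linarith, h3.le⟩
    · have hα : α t = A k (t - s k) := by simp only [α, hfind k t h1' h2']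
      rw [hα, hy k t h1 h2]
      refine (hasDerivWithinAt_shift (hYd k (t - s k) ⟨by linarith, h3⟩)).congr_of_eventuallyEq
        ?_ (hy k t h1 h2)
      filter_upwards [mem_nhdsWithin_of_mem_nhds (Iio_mem_nhds h2'), self_mem_nhdsWithin]
        with r hr hr'
      exact hy k r (h1'.trans hr') hr

theorem norm_controlSet_apply_le {a : Fin m → ℝ} (ha : a ∈ controlSet m) (i : Fin m) :
    ‖a i‖ ≤ 1 := by
  obtain ⟨j, rfl | rfl⟩ := ha <;>
  · by_cases h : i = j
    · subst h; simp
    · simp [h]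

/-- A continuous curve in the domain which satisfies the differential equation in the sense of
right derivatives is a solution. -/
theorem isSolution_of_hasDerivWithinAt {f : Fin m → State n → State n} {T : Set (State n)}
    (hf : ∀ i, ContinuousOn (f i) Tᶜ) {x : State n} {y : ℝ → State n} {α : ℝ → Fin m → ℝ}
    {S : EReal} (hS : 0 < S) (h0 : y 0 = x) (hαm : Measurable α)
    (hαA : ∀ t, α t ∈ controlSet m)
    (hc : ContinuousOn y {t : ℝ | 0 ≤ t ∧ (t : EReal) < S})
    (hmem : ∀ t : ℝ, 0 ≤ t → (t : EReal) < S → y t ∈ Tᶜ)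
    (hd : ∀ t : ℝ, 0 ≤ t → (t : EReal) < S →
      HasDerivWithinAt y (∑ i, α t i • f i (y t)) (Ici t) t) :
    IsSolution f T x y α S := by
  have hlt : ∀ t : ℝ, (t : EReal) < S → ∀ s ∈ Icc 0 t, 0 ≤ s ∧ (s : EReal) < S :=
    fun t ht s hs => ⟨hs.1, lt_of_le_of_lt (EReal.coe_le_coe_iff.2 hs.2) ht⟩
  have hint : ∀ t : ℝ, 0 ≤ t → (t : EReal) < S →
      IntervalIntegrable (fun s => ∑ i, α s i • f i (y s)) MeasureTheory.volume 0 t := by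
    intro t ht htS
    have hsum : ∀ i, IntervalIntegrable (fun s => α s i • f i (y s)) MeasureTheory.volume 0 t := by
      intro i
      have hcy : ContinuousOn (fun s => f i (y s)) (Icc 0 t) :=
        (hf i).comp (hc.mono (hlt t htS)) fun s hs => hmem s (hlt t htS s hs).1 (hlt t htS s hs).2
      have hi : IntervalIntegrable (fun s => f i (y s)) MeasureTheory.volume 0 t := by
        refine ContinuousOn.intervalIntegrable ?_
        rwa [uIcc_of_le ht]
      rw [intervalIntegrable_iff] at hi ⊢
      refine MeasureTheory.Integrable.bdd_smul (φ := fun s => α s i) hi 1 ?_ ?_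
      · exact ((measurable_pi_apply i).comp hαm).aestronglyMeasurable
      · exact Eventually.of_forall fun s => norm_controlSet_apply_le (hαA s) i
    have := IntervalIntegrable.sum Finset.univ fun i _ => hsum i
    rwa [Finset.sum_fn] at this
  refine ⟨hS, h0, hc, hmem, hint, fun t ht htS => ?_⟩
  rw [intervalIntegral.integral_eq_sub_of_hasDeriv_right_of_le ht (hc.mono (hlt t htS))
    (fun s hs => ?_) (hint t ht htS), h0]
  · abel
  · have := hlt t htS s ⟨hs.1.le, hs.2.le⟩
    exact (hd s this.1 this.2).mono Ioi_subset_Ici_self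

end LieCLF

/-! ### Flows of bounded Lipschitz fields -/

namespace LieCLF

/-- The nearest point projection onto a nonempty complete convex set is a nonexpansive
retraction. -/
theorem exists_nonexpansive_retraction {E : Type*} [NormedAddCommGroup E] [InnerProductSpace ℝ E]
    {C : Set E} (hne : C.Nonempty) (hcomp : IsComplete C) (hconv : Convex ℝ C) :
    ∃ P : E → E, LipschitzWith 1 P ∧ (∀ x, P x ∈ C) ∧ ∀ x ∈ C, P x = x := by
  have hex : ∀ x : E, ∃ v ∈ C, ∀ w ∈ C, inner ℝ (x - v) (w - v) ≤ 0 := by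
    intro x
    obtain ⟨v, hv, h⟩ := exists_norm_eq_iInf_of_complete_convex hne hcomp hconv x
    exact ⟨v, hv, (norm_eq_iInf_iff_real_inner_le_zero hconv hv).1 h⟩
  choose P hPC hP using hex
  refine ⟨P, LipschitzWith.of_dist_le_mul fun x z => ?_, hPC, fun x hx => ?_⟩
  · have h1 := hP x (P z) (hPC z)
    have h2 := hP z (P x) (hPC x)
    -- Adding the two variational inequalities gives firm nonexpansiveness; Cauchy–Schwarz finishes.
    have h3 : ‖P x - P z‖ ^ 2 ≤ inner ℝ (x - z) (P x - P z) := by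
      rw [← real_inner_self_eq_norm_sq]
      have e1 : inner ℝ (x - P x) (P z - P x) = - inner ℝ (x - P x) (P x - P z) := by
        rw [← inner_neg_right, neg_sub]
      have e2 : inner ℝ (x - z) (P x - P z) = inner ℝ (x - P x) (P x - P z)
          + inner ℝ (P x - P z) (P x - P z) - inner ℝ (z - P z) (P x - P z) := by
        rw [← inner_add_left, ← inner_sub_left]; congr 1; abel
      linarith
    have h4 := real_inner_le_norm (x - z) (P x - P z)
    rw [dist_eq_norm, dist_eq_norm, NNReal.coe_one, one_mul]
    by_contra hlt
    push Not at hlt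
    nlinarith [norm_nonneg (x - z), norm_nonneg (P x - P z)]
  · have := hP x x hx
    rw [real_inner_self_eq_norm_sq] at this
    have h0 : ‖x - P x‖ = 0 := by nlinarith [norm_nonneg (x - P x)]
    rw [norm_eq_zero, sub_eq_zero] at h0
    exact h0.symm

/-- `φ` is a flow of the vector field `G` on the time interval `[0,1]`. -/
def IsUnitFlow {n : ℕ} (G : State n → State n) (φ : State n → ℝ → State n) : Prop :=
  ∀ x, φ x 0 = x ∧ ∀ t ∈ Icc (0 : ℝ) 1, HasDerivWithinAt (φ x) (G (φ x t)) (Icc 0 1) t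

variable {n : ℕ} {G : State n → State n} {K : NNReal} {M : ℝ} {φ : State n → ℝ → State n}

/-- Picard–Lindelöf on the ball of radius `M`, which a curve of speed at most `M` cannot leave
within time 1. -/
theorem exists_isUnitFlow (hG : LipschitzWith K G) (hM : ∀ x, ‖G x‖ ≤ M) :
    ∃ φ, IsUnitFlow G φ := by
  have hex : ∀ x : State n, ∃ y : ℝ → State n, y 0 = x ∧
      ∀ t ∈ Icc (0 : ℝ) 1, HasDerivWithinAt y (G (y t)) (Icc 0 1) t := by
    intro x
    have hM0 : 0 ≤ M := (norm_nonneg _).trans (hM x)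
    have hpl : IsPicardLindelof (fun _ => G) (tmin := 0) (tmax := 1) ⟨0, by simp⟩ x
        ⟨M, hM0⟩ 0 ⟨M, hM0⟩ K :=
      IsPicardLindelof.of_time_independent (fun z _ => hM z) hG.lipschitzOnWith (by simp)
    exact hpl.exists_eq_forall_mem_Icc_hasDerivWithinAt₀
  choose φ hφ using hex
  exact ⟨φ, hφ⟩

namespace IsUnitFlow

theorem continuousOn (h : IsUnitFlow G φ) (x : State n) : ContinuousOn (φ x) (Icc 0 1) :=
  fun t ht => ((h x).2 t ht).continuousWithinAt

theorem hasDerivWithinAt_Ici (h : IsUnitFlow G φ) (x : State n) {t : ℝ} (ht : t ∈ Ico (0 : ℝ) 1) :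
    HasDerivWithinAt (φ x) (G (φ x t)) (Ici t) t :=
  ((h x).2 t ⟨ht.1, ht.2.le⟩).mono_of_mem_nhdsWithin
    (mem_of_superset (Icc_mem_nhdsGE ht.2) (Icc_subset_Icc_left ht.1))

theorem norm_sub_le (h : IsUnitFlow G φ) (hM : ∀ x, ‖G x‖ ≤ M) (x : State n) {t : ℝ}
    (ht : t ∈ Icc (0 : ℝ) 1) : ‖φ x t - x‖ ≤ M * t := by
  have := (convex_Icc (0:ℝ) 1).norm_image_sub_le_of_norm_hasDerivWithin_le
    (fun s hs => (h x).2 s hs) (fun s _ => hM _) (left_mem_Icc.2 zero_le_one) ht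
  rwa [(h x).1, sub_zero, Real.norm_of_nonneg ht.1] at this

/-- Grönwall. This lets a control word that lowers `U` at one point lower it at all neighbouring
points. -/
theorem continuous_apply (h : IsUnitFlow G φ) (hG : LipschitzWith K G) {t : ℝ}
    (ht : t ∈ Icc (0 : ℝ) 1) : Continuous fun x => φ x t := by
  refine (LipschitzWith.of_dist_le_mul (K := Real.toNNReal (Real.exp (K * t)))
    fun x z => ?_).continuous
  rw [Real.coe_toNNReal _ (Real.exp_pos _).le, mul_comm]
  have := dist_le_of_trajectories_ODE (v := fun _ => G) (K := K) (fun _ => hG) (h.continuousOn x)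
    (fun s hs => h.hasDerivWithinAt_Ici x hs) (h.continuousOn z)
    (fun s hs => h.hasDerivWithinAt_Ici z hs) (δ := dist x z) (by rw [(h x).1, (h z).1]) t ht
  simpa using this

theorem steers {m : ℕ} {f : Fin m → State n → State n} {V : Set (State n)} {a : Fin m → ℝ}
    (h : IsUnitFlow G φ) (ha : a ∈ controlSet m) (hG : ∀ v ∈ V, G v = ∑ i, a i • f i v)
    {x : State n} {τ : ℝ} (hτ : τ ≤ 1) (hV : ∀ t ∈ Icc 0 τ, φ x t ∈ V) :
    Steers f V x (φ x τ) τ := by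
  refine ⟨φ x, fun _ => a, (h x).1, rfl, (h.continuousOn x).mono (Icc_subset_Icc_right hτ), hV,
    measurable_const, fun _ => ha, fun t ht => ?_⟩
  have := h.hasDerivWithinAt_Ici x ⟨ht.1, ht.2.trans_le hτ⟩
  rwa [hG _ (hV t ⟨ht.1, ht.2.le⟩)] at this

/-- A first-order expansion of one leg of a composition of flows, started near `x₀`. -/
theorem norm_sub_affine_le (h : IsUnitFlow G φ) (hG : LipschitzWith K G) (hM : ∀ x, ‖G x‖ ≤ M)
    {x x₀ a : State n} {t d e : ℝ} (ht : t ∈ Icc (0 : ℝ) 1) (hd : ‖x - x₀‖ ≤ d)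
    (he : ‖x - a‖ ≤ e) {s : ℝ} (hs : s ∈ Icc 0 t) :
    ‖φ x s - (a + s • G x₀)‖ ≤ e + K * (d + M * t) * t := by
  -- Here `x` is the true start of the leg, `a` the parallelogram vertex it approximates, and `x₀`
  -- the base point at which the field is frozen.
  have hM0 : 0 ≤ M := (norm_nonneg _).trans (hM x)
  have hd0 : 0 ≤ d := (norm_nonneg _).trans hd
  have hder : ∀ r ∈ Icc 0 t, HasDerivWithinAt (fun r => φ x r - r • G x₀)
      (G (φ x r) - G x₀) (Icc 0 t) r := by
    intro r hr
    have h1 := ((h x).2 r ⟨hr.1, hr.2.trans ht.2⟩).mono (Icc_subset_Icc_right ht.2 :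
      Icc 0 t ⊆ Icc 0 1)
    have h2 := ((hasDerivAt_id r).smul_const (G x₀)).hasDerivWithinAt (s := Icc 0 t)
    rw [one_smul] at h2
    exact h1.sub h2
  have hbd : ∀ r ∈ Icc 0 t, ‖G (φ x r) - G x₀‖ ≤ K * (d + M * t) := by
    intro r hr
    refine (hG.norm_sub_le _ _).trans (mul_le_mul_of_nonneg_left ?_ K.2)
    have h1 := h.norm_sub_le hM x (t := r) ⟨hr.1, hr.2.trans ht.2⟩
    have h2 : φ x r - x₀ = (φ x r - x) + (x - x₀) := by abel
    rw [h2]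
    have h3 : M * r ≤ M * t := mul_le_mul_of_nonneg_left hr.2 hM0
    exact (norm_add_le _ _).trans (by linarith)
  have hmv := (convex_Icc (0:ℝ) t).norm_image_sub_le_of_norm_hasDerivWithin_le hder hbd
    (left_mem_Icc.2 ht.1) hs
  simp only [zero_smul, sub_zero, (h x).1, Real.norm_of_nonneg hs.1] at hmv
  have hK : (0:ℝ) ≤ K := K.2
  have h4 : K * (d + M * t) * s ≤ K * (d + M * t) * t :=
    mul_le_mul_of_nonneg_left hs.2 (mul_nonneg hK (add_nonneg hd0 (mul_nonneg hM0 ht.1)))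
  have h5 : φ x s - (a + s • G x₀) = (φ x s - s • G x₀ - x) + (x - a) := by abel
  rw [h5]
  exact (norm_add_le _ _).trans (by linarith)

/-- The displacement along one leg, up to third order, involves only the values of the field on a
segment. -/
theorem norm_displacement_sub_le (h : IsUnitFlow G φ) (hG : LipschitzWith K G)
    (hM : ∀ x, ‖G x‖ ≤ M) {x x₀ a : State n} {t d e : ℝ} (ht : t ∈ Icc (0 : ℝ) 1)
    (hd : ‖x - x₀‖ ≤ d) (he : ‖x - a‖ ≤ e) :
    ‖φ x t - x - ∫ s in (0:ℝ)..t, G (a + s • G x₀)‖ ≤ K * (e + K * (d + M * t) * t) * t := by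
  have hsub : Icc 0 t ⊆ Icc (0:ℝ) 1 := Icc_subset_Icc_right ht.2
  have hc1 : ContinuousOn (fun s => G (φ x s)) (uIcc 0 t) := by
    rw [uIcc_of_le ht.1]
    exact hG.continuous.comp_continuousOn ((h.continuousOn x).mono hsub)
  have hc2 : Continuous fun s : ℝ => G (a + s • G x₀) := hG.continuous.comp (by fun_prop)
  -- The displacement is the integral of `G` along the true path; replacing the path by its affine
  -- approximation costs `K` times the error of the previous lemma, hence `O(t³)` when `d = O(t)`
  -- and `e = O(t²)`.
  have hint : ∫ s in (0:ℝ)..t, G (φ x s) = φ x t - x := by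
    rw [intervalIntegral.integral_eq_sub_of_hasDeriv_right_of_le ht.1
      ((h.continuousOn x).mono hsub) (fun s hs => ?_) hc1.intervalIntegrable, (h x).1]
    exact (h.hasDerivWithinAt_Ici x ⟨hs.1.le, hs.2.trans_le ht.2⟩).mono Ioi_subset_Ici_self
  rw [← hint, ← intervalIntegral.integral_sub hc1.intervalIntegrable
    (hc2.intervalIntegrable _ _)]
  have := intervalIntegral.norm_integral_le_of_norm_le_const (a := 0) (b := t)
    (C := K * (e + K * (d + M * t) * t)) (f := fun s => G (φ x s) - G (a + s • G x₀)) (by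
      intro s hs
      rw [uIoc_of_le ht.1] at hs
      exact (hG.norm_sub_le _ _).trans (mul_le_mul_of_nonneg_left
        (h.norm_sub_affine_le hG hM ht hd he ⟨hs.1.le, hs.2⟩) K.2))
  rwa [sub_zero, abs_of_nonneg ht.1] at this

end IsUnitFlow

end LieCLF

/-! ### Green's inequality and the commutator expansion -/

namespace LieCLF

open MeasureTheory

variable {n : ℕ}

/-- A property which holds almost everywhere holds almost everywhere on almost every translate of a
parametrized plane. -/
theorem ae_ae_prod_add {Q : State n → Prop} (hQ : ∀ᵐ x, Q x) (a b : State n) :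
    ∀ᵐ z : State n, ∃ Q' : State n → Prop, MeasurableSet {x | Q' x} ∧ (∀ x, Q' x → Q x) ∧
      ∀ᵐ q : ℝ × ℝ, Q' (z + q.1 • a + q.2 • b) := by
  -- The exceptional set is enlarged to a measurable null set so that the order of the almost
  -- everywhere quantifiers can be exchanged.
  have hN := measurableSet_toMeasurable (volume : Measure (State n)) {x | ¬ Q x}
  set N := toMeasurable (volume : Measure (State n)) {x | ¬ Q x} with hNdef
  have hN0 : ∀ᵐ x : State n, x ∉ N := by
    rw [ae_iff]
    simp only [not_not, ofPred_mem_eq, hNdef, measure_toMeasurable]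
    exact hQ
  have hmeas : MeasurableSet {w : (ℝ × ℝ) × State n | w.2 + w.1.1 • a + w.1.2 • b ∉ N} := by
    have hc : Continuous fun w : (ℝ × ℝ) × State n => w.2 + w.1.1 • a + w.1.2 • b := by fun_prop
    exact hc.measurable hN.compl
  have h1 : ∀ᵐ q : ℝ × ℝ, ∀ᵐ z : State n, z + q.1 • a + q.2 • b ∉ N := by
    refine Eventually.of_forall fun q => ?_
    have := (eventually_add_right_iff (volume : Measure (State n)) (q.1 • a + q.2 • b)
      (p := fun x => x ∉ N)).2 hN0
    simpa only [add_assoc] using this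
  rw [Measure.ae_ae_comm (p := fun (q : ℝ × ℝ) (z : State n) => z + q.1 • a + q.2 • b ∉ N) hmeas]
    at h1
  filter_upwards [h1] with z hz
  exact ⟨fun x => x ∉ N, hN.compl, fun x hx => by
    by_contra h
    exact hx (subset_toMeasurable _ _ h), hz⟩

/-- The derivative of a real Lipschitz function along a line integrates to its increment. -/
theorem integral_fderiv_line {u : State n → ℝ} {K : NNReal} (hu : LipschitzWith K u)
    (z a : State n) (t : ℝ)
    (hd : ∀ᵐ s ∂(volume.restrict (uIoc 0 t)), DifferentiableAt ℝ u (z + s • a)) :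
    ∫ s in (0:ℝ)..t, fderiv ℝ u (z + s • a) a = u (z + t • a) - u z := by
  have hlip : LipschitzWith (K * ‖a‖₊) fun s : ℝ => u (z + s • a) := by
    refine hu.comp (LipschitzWith.of_dist_le_mul fun s r => ?_)
    rw [dist_add_left, dist_eq_norm, ← sub_smul, norm_smul, mul_comm, Real.dist_eq]
    rfl
  have h := (hlip.lipschitzOnWith (s := uIcc 0 t)).absolutelyContinuousOnInterval.integral_deriv_eq_sub
  rw [zero_smul, add_zero] at h
  rw [← h]
  refine intervalIntegral.integral_congr_ae_restrict ?_
  filter_upwards [hd] with s hs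
  have h1 : HasDerivAt (fun s : ℝ => z + s • a) a s := by
    have := ((hasDerivAt_id s).smul_const a).const_add z
    rw [one_smul] at this
    exact this
  exact (hs.hasFDerivAt.comp_hasDerivAt s h1).deriv.symm

/-- The circulation of a Lipschitz field along a parallelogram is controlled by the almost
everywhere defined curl (Green's formula as an inequality), for parallelograms on which the
derivatives exist almost everywhere. -/
theorem circulation_le_of_ae {u v : State n → ℝ} {K : NNReal} (hu : LipschitzWith K u)
    (hv : LipschitzWith K v) {z a b : State n} {c t : ℝ} (ht : 0 ≤ t)
    {Q : State n → Prop} (hQm : MeasurableSet {x | Q x})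
    (hQu : ∀ x, Q x → DifferentiableAt ℝ u x) (hQv : ∀ x, Q x → DifferentiableAt ℝ v x)
    (hQc : ∀ s ∈ Icc 0 t, ∀ r ∈ Icc 0 t, Q (z + s • a + r • b) →
      fderiv ℝ v (z + s • a + r • b) a - fderiv ℝ u (z + s • a + r • b) b ≤ c)
    (hQ : ∀ᵐ q : ℝ × ℝ, Q (z + q.1 • a + q.2 • b)) :
    (∫ r in (0:ℝ)..t, (v (z + t • a + r • b) - v (z + r • b)))
      - ∫ s in (0:ℝ)..t, (u (z + s • a + t • b) - u (z + s • a)) ≤ c * t ^ 2 := by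
  set μ : Measure ℝ := volume.restrict (Ioc 0 t) with hμ
  have hcont : Continuous fun q : ℝ × ℝ => z + q.1 • a + q.2 • b := by fun_prop
  have hQν : ∀ᵐ q ∂(μ.prod μ), Q (z + q.1 • a + q.2 • b) := by
    rw [hμ, Measure.prod_restrict]
    exact ae_restrict_of_ae hQ
  have hmeas : MeasurableSet {q : ℝ × ℝ | Q (z + q.1 • a + q.2 • b)} := hcont.measurable hQm
  have hQ1 : ∀ᵐ s ∂μ, ∀ᵐ r ∂μ, Q (z + s • a + r • b) := Measure.ae_ae_of_ae_prod hQν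
  have hQ2 : ∀ᵐ r ∂μ, ∀ᵐ s ∂μ, Q (z + s • a + r • b) :=
    (Measure.ae_ae_comm (p := fun s r => Q (z + s • a + r • b)) hmeas).1 hQ1
  have hintv : ∀ (w : State n → ℝ), LipschitzWith K w → ∀ e : State n,
      Integrable (fun q : ℝ × ℝ => fderiv ℝ w (z + q.1 • a + q.2 • b) e) (μ.prod μ) := by
    intro w hw e
    refine Integrable.of_bound (C := K * ‖e‖) ?_ (Eventually.of_forall fun q => ?_)
    · exact ((measurable_fderiv_apply_const ℝ w e).comp hcont.measurable).aestronglyMeasurable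
    · exact (ContinuousLinearMap.le_opNorm _ _).trans
        (mul_le_mul_of_nonneg_right (norm_fderiv_le_of_lipschitz ℝ hw) (norm_nonneg _))
  -- Each pair of opposite sides becomes a double integral of a directional derivative, by the
  -- fundamental theorem along lines and Fubini.
  have ev : ∫ r in (0:ℝ)..t, (v (z + t • a + r • b) - v (z + r • b))
      = ∫ q, fderiv ℝ v (z + q.1 • a + q.2 • b) a ∂(μ.prod μ) := by
    rw [integral_prod_symm _ (hintv v hv a), intervalIntegral.integral_of_le ht]
    refine integral_congr_ae ?_
    filter_upwards [hQ2] with r hr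
    have := integral_fderiv_line hv (z + r • b) a t (by
      rw [uIoc_of_le ht]
      filter_upwards [hr] with s hs
      rw [add_right_comm]
      exact hQv _ hs)
    rw [intervalIntegral.integral_of_le ht] at this
    simp only [add_right_comm z (r • b)] at this
    exact this.symm
  have eu : ∫ s in (0:ℝ)..t, (u (z + s • a + t • b) - u (z + s • a))
      = ∫ q, fderiv ℝ u (z + q.1 • a + q.2 • b) b ∂(μ.prod μ) := by
    rw [integral_prod _ (hintv u hu b), intervalIntegral.integral_of_le ht]
    refine integral_congr_ae ?_
    filter_upwards [hQ1] with s hs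
    have := integral_fderiv_line hu (z + s • a) b t (by
      rw [uIoc_of_le ht]
      filter_upwards [hs] with r hr using hQu _ hr)
    rw [intervalIntegral.integral_of_le ht] at this
    exact this.symm
  rw [ev, eu, ← integral_sub (hintv v hv a) (hintv u hu b)]
  have hle := integral_mono_ae (μ := μ.prod μ) ((hintv v hv a).sub (hintv u hu b))
    (integrable_const c) (by
      have hmem : ∀ᵐ q ∂(μ.prod μ), q ∈ Ioc 0 t ×ˢ Ioc 0 t := by
        rw [hμ, Measure.prod_restrict]
        exact ae_restrict_mem (measurableSet_Ioc.prod measurableSet_Ioc)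
      filter_upwards [hQν, hmem] with q hq hq'
      exact hQc q.1 (Ioc_subset_Icc_self hq'.1) q.2 (Ioc_subset_Icc_self hq'.2) hq)
  refine hle.trans_eq ?_
  rw [integral_const, hμ, Measure.prod_restrict, measureReal_restrict_apply_univ,
    measureReal_prod_prod]
  simp [ht]; ring

/-- Green's formula as an inequality for Lipschitz fields: the circulation along a small
parallelogram is at most its area times the essential supremum of the curl. -/
theorem circulation_le {u v : State n → ℝ} {K : NNReal} (hu : LipschitzWith K u)
    (hv : LipschitzWith K v) {x₀ a b : State n} {c δ t : ℝ} (ht : 0 ≤ t)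
    (hδ : t * (‖a‖ + ‖b‖) < δ)
    (hc : ∀ᵐ x, x ∈ Metric.ball x₀ δ → fderiv ℝ v x a - fderiv ℝ u x b ≤ c) :
    (∫ r in (0:ℝ)..t, (v (x₀ + t • a + r • b) - v (x₀ + r • b)))
      - ∫ s in (0:ℝ)..t, (u (x₀ + s • a + t • b) - u (x₀ + s • a)) ≤ c * t ^ 2 := by
  have hgood : ∀ᵐ x : State n, DifferentiableAt ℝ u x ∧ DifferentiableAt ℝ v x ∧
      (x ∈ Metric.ball x₀ δ → fderiv ℝ v x a - fderiv ℝ u x b ≤ c) := by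
    filter_upwards [hu.ae_differentiableAt, hv.ae_differentiableAt, hc] with x h1 h2 h3
    exact ⟨h1, h2, h3⟩
  -- The given parallelogram may be Lebesgue null, so almost everywhere differentiability need not
  -- say anything about it. Good translates are dense, and the circulation is continuous in the base
  -- point.
  have hdense := Measure.dense_of_ae (ae_ae_prod_add hgood a b)
  set Φ : State n → ℝ := fun z =>
    (∫ r in (0:ℝ)..t, (v (z + t • a + r • b) - v (z + r • b)))
      - ∫ s in (0:ℝ)..t, (u (z + s • a + t • b) - u (z + s • a)) with hΦ
  have hΦc : Continuous Φ := by
    have hvc := hv.continuous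
    have huc := hu.continuous
    refine Continuous.sub ?_ ?_
    · refine intervalIntegral.continuous_parametric_intervalIntegral_of_continuous' ?_ _ _
      exact (hvc.comp (by fun_prop)).sub (hvc.comp (by fun_prop))
    · refine intervalIntegral.continuous_parametric_intervalIntegral_of_continuous' ?_ _ _
      exact (huc.comp (by fun_prop)).sub (huc.comp (by fun_prop))
  by_contra hlt
  push Not at hlt
  obtain ⟨z, ⟨hz1, hz2⟩, Q', hQm, hQ, hz⟩ := hdense.inter_open_nonempty
    ({z | c * t ^ 2 < Φ z} ∩ Metric.ball x₀ (δ - t * (‖a‖ + ‖b‖)))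
    ((isOpen_lt continuous_const hΦc).inter Metric.isOpen_ball)
    ⟨x₀, hlt, Metric.mem_ball_self (by linarith)⟩
  refine absurd (circulation_le_of_ae hu hv ht hQm (fun x hx => (hQ x hx).1)
    (fun x hx => (hQ x hx).2.1) (fun s hs r hr hx => (hQ _ hx).2.2 ?_) hz) (not_le.2 hz1)
  rw [Metric.mem_ball, dist_eq_norm] at hz2 ⊢
  have e : z + s • a + r • b - x₀ = (z - x₀) + s • a + r • b := by abel
  rw [e]
  have h1 : ‖s • a‖ ≤ t * ‖a‖ := by
    rw [norm_smul, Real.norm_of_nonneg hs.1]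
    exact mul_le_mul_of_nonneg_right hs.2 (norm_nonneg _)
  have h2 : ‖r • b‖ ≤ t * ‖b‖ := by
    rw [norm_smul, Real.norm_of_nonneg hr.1]
    exact mul_le_mul_of_nonneg_right hr.2 (norm_nonneg _)
  have := norm_add₃_le (a := z - x₀) (b := s • a) (c := r • b)
  linarith

/-- The end point of the commutator `e^{-tG} e^{-tF} e^{tG} e^{tF} x₀`: it is `O(t²)`-close to `x₀`,
and up to third order its displacement is a circulation along a parallelogram. -/
theorem norm_commutator_sub_le {F G : State n → State n} {K : NNReal} {M : ℝ}
    (hF : LipschitzWith K F) (hG : LipschitzWith K G) (hFM : ∀ x, ‖F x‖ ≤ M)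
    (hGM : ∀ x, ‖G x‖ ≤ M) {φ₁ φ₂ φ₃ φ₄ : State n → ℝ → State n} (h₁ : IsUnitFlow F φ₁)
    (h₂ : IsUnitFlow G φ₂) (h₃ : IsUnitFlow (fun x => -F x) φ₃)
    (h₄ : IsUnitFlow (fun x => -G x) φ₄) (x₀ : State n) {t : ℝ} (ht : t ∈ Icc (0 : ℝ) 1) :
    ‖φ₄ (φ₃ (φ₂ (φ₁ x₀ t) t) t) t - x₀‖ ≤ 10 * K * M * t ^ 2 ∧
    ‖φ₄ (φ₃ (φ₂ (φ₁ x₀ t) t) t) t - x₀ -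
      ((∫ r in (0:ℝ)..t, (G (x₀ + t • F x₀ + r • G x₀) - G (x₀ + r • G x₀)))
        - ∫ s in (0:ℝ)..t, (F (x₀ + s • F x₀ + t • G x₀) - F (x₀ + s • F x₀)))‖
      ≤ 20 * K ^ 2 * M * t ^ 3 := by
  have hF' : LipschitzWith K fun x => -F x := hF.neg
  have hG' : LipschitzWith K fun x => -G x := hG.neg
  have hFM' : ∀ x, ‖-F x‖ ≤ M := fun x => by rw [norm_neg]; exact hFM x
  have hGM' : ∀ x, ‖-G x‖ ≤ M := fun x => by rw [norm_neg]; exact hGM x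
  set a := F x₀ with ha
  set b := G x₀ with hb
  set x₁ := φ₁ x₀ t with hx₁
  set x₂ := φ₂ x₁ t with hx₂
  set x₃ := φ₃ x₂ t with hx₃
  set x₄ := φ₄ x₃ t with hx₄
  have tt : t ∈ Icc 0 t := ⟨ht.1, le_rfl⟩
  have d0 : ‖x₀ - x₀‖ ≤ 0 := by simp
  have d1 : ‖x₁ - x₀‖ ≤ M * t := h₁.norm_sub_le hFM x₀ ht
  have d2 : ‖x₂ - x₀‖ ≤ 2 * (M * t) := by
    have := h₂.norm_sub_le hGM x₁ ht
    have e : x₂ - x₀ = (x₂ - x₁) + (x₁ - x₀) := by abel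
    rw [e]; exact (norm_add_le _ _).trans (by linarith)
  have d3 : ‖x₃ - x₀‖ ≤ 3 * (M * t) := by
    have := h₃.norm_sub_le hFM' x₂ ht
    have e : x₃ - x₀ = (x₃ - x₂) + (x₂ - x₀) := by abel
    rw [e]; exact (norm_add_le _ _).trans (by linarith)
  have e0 : ‖x₀ - x₀‖ ≤ 0 := d0
  -- Leg `k` starts within `(k - 1) M t` of `x₀` and adds `k K M t²` to the error, hence the
  -- triangular numbers 1, 3, 6, 10. The third-order errors below carry the same factors, with sum
  -- 20.
  have e1 : ‖x₁ - (x₀ + t • a)‖ ≤ K * (M * t) * t :=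
    (h₁.norm_sub_affine_le hF hFM ht d0 e0 tt).trans (le_of_eq (by ring))
  have e2 : ‖x₂ - (x₀ + t • a + t • b)‖ ≤ 3 * (K * (M * t) * t) :=
    (h₂.norm_sub_affine_le hG hGM ht d1 e1 tt).trans (le_of_eq (by ring))
  have e3 : ‖x₃ - (x₀ + t • b)‖ ≤ 6 * (K * (M * t) * t) := by
    have h := (h₃.norm_sub_affine_le hF' hFM' ht d2 e2 tt)
    have e : x₀ + t • a + t • b + t • -a = x₀ + t • b := by rw [smul_neg]; abel
    simp only [← ha] at h
    rw [e] at h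
    exact h.trans (le_of_eq (by ring))
  have e4 : ‖x₄ - x₀‖ ≤ 10 * (K * (M * t) * t) := by
    have h := (h₄.norm_sub_affine_le hG' hGM' ht d3 e3 tt)
    have e : x₀ + t • b + t • -b = x₀ := by rw [smul_neg]; abel
    simp only [← hb] at h
    rw [e] at h
    exact h.trans (le_of_eq (by ring))
  refine ⟨e4.trans (le_of_eq (by ring)), ?_⟩
  have g1 := h₁.norm_displacement_sub_le hF hFM ht d0 e0
  have g2 := h₂.norm_displacement_sub_le hG hGM ht d1 e1
  have g3 := h₃.norm_displacement_sub_le hF' hFM' ht d2 e2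
  have g4 := h₄.norm_displacement_sub_le hG' hGM' ht d3 e3
  simp only [← ha, ← hb, ← hx₁, ← hx₂, ← hx₃, ← hx₄] at g1 g2 g3 g4
  -- The last two legs run backwards along the opposite sides; `s ↦ t - s` reverses them.
  have r3 : ∫ s in (0:ℝ)..t, -F (x₀ + t • a + t • b + s • -a)
      = -∫ s in (0:ℝ)..t, F (x₀ + s • a + t • b) := by
    rw [intervalIntegral.integral_neg, neg_inj]
    have := intervalIntegral.integral_comp_sub_left (a := 0) (b := t)
      (fun s => F (x₀ + s • a + t • b)) t
    rw [sub_self, sub_zero] at this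
    rw [← this]
    congr 1; ext1 s; congr 1
    rw [sub_smul, smul_neg]; abel
  have r4 : ∫ s in (0:ℝ)..t, -G (x₀ + t • b + s • -b)
      = -∫ s in (0:ℝ)..t, G (x₀ + s • b) := by
    rw [intervalIntegral.integral_neg, neg_inj]
    have := intervalIntegral.integral_comp_sub_left (a := 0) (b := t)
      (fun s => G (x₀ + s • b)) t
    rw [sub_self, sub_zero] at this
    rw [← this]
    congr 1; ext1 s; congr 1
    rw [sub_smul, smul_neg]; abel
  rw [r3] at g3
  rw [r4] at g4
  have hFc := hF.continuous
  have hGc := hG.continuous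
  have c1 : Continuous fun r : ℝ => G (x₀ + t • a + r • b) := hGc.comp (by fun_prop)
  have c2 : Continuous fun r : ℝ => G (x₀ + r • b) := hGc.comp (by fun_prop)
  have c3 : Continuous fun s : ℝ => F (x₀ + s • a + t • b) := hFc.comp (by fun_prop)
  have c4 : Continuous fun s : ℝ => F (x₀ + s • a) := hFc.comp (by fun_prop)
  rw [intervalIntegral.integral_sub (c1.intervalIntegrable _ _) (c2.intervalIntegrable _ _),
    intervalIntegral.integral_sub (c3.intervalIntegrable _ _) (c4.intervalIntegrable _ _)]
  set I1 := ∫ s in (0:ℝ)..t, F (x₀ + s • a)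
  set I2 := ∫ s in (0:ℝ)..t, G (x₀ + t • a + s • b)
  set I3 := ∫ s in (0:ℝ)..t, F (x₀ + s • a + t • b)
  set I4 := ∫ s in (0:ℝ)..t, G (x₀ + s • b)
  have e : x₄ - x₀ - (I2 - I4 - (I3 - I1)) = (x₁ - x₀ - I1) + (x₂ - x₁ - I2)
      + (x₃ - x₂ - -I3) + (x₄ - x₃ - -I4) := by abel
  rw [e]
  have n1 := norm_add_le (x₁ - x₀ - I1 + (x₂ - x₁ - I2) + (x₃ - x₂ - -I3)) (x₄ - x₃ - -I4)
  have n2 := norm_add_le (x₁ - x₀ - I1 + (x₂ - x₁ - I2)) (x₃ - x₂ - -I3)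
  have n3 := norm_add_le (x₁ - x₀ - I1) (x₂ - x₁ - I2)
  linarith

end LieCLF

/-! ### Limiting brackets and second-order decrease -/

namespace LieCLF

open MeasureTheory

variable {n : ℕ}

theorem norm_lieBracket_le {f g : State n → State n} {x : State n} {s : Set (State n)}
    (hs : s ∈ 𝓝 x) {K : NNReal} {M : ℝ} (hf : LipschitzOnWith K f s) (hg : LipschitzOnWith K g s)
    (hfM : ‖f x‖ ≤ M) (hgM : ‖g x‖ ≤ M) : ‖VectorField.lieBracket ℝ f g x‖ ≤ 2 * (K * M) := by
  have h1 : ‖fderiv ℝ g x (f x)‖ ≤ K * M := (ContinuousLinearMap.le_opNorm _ _).trans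
    (mul_le_mul (norm_fderiv_le_of_lipschitzOn ℝ hs hg) hfM (norm_nonneg _) K.2)
  have h2 : ‖fderiv ℝ f x (g x)‖ ≤ K * M := (ContinuousLinearMap.le_opNorm _ _).trans
    (mul_le_mul (norm_fderiv_le_of_lipschitzOn ℝ hs hf) hgM (norm_nonneg _) K.2)
  exact (norm_sub_le _ _).trans (by linarith)

/-- Upper semicontinuity of the support function of the set of limiting Lie brackets. -/
theorem exists_forall_inner_lieBracket_le {Ω : Set (State n)} {f g : State n → State n}
    {x₀ p : State n} {r M c c' : ℝ} {K : NNReal} (hr : 0 < r) (hΩ : Metric.ball x₀ r ⊆ Ω)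
    (hf : LipschitzOnWith K f (Metric.ball x₀ r)) (hg : LipschitzOnWith K g (Metric.ball x₀ r))
    (hfM : ∀ x ∈ Metric.ball x₀ r, ‖f x‖ ≤ M) (hgM : ∀ x ∈ Metric.ball x₀ r, ‖g x‖ ≤ M)
    (hc : ∀ w ∈ limitBrackets Ω f g x₀, inner ℝ p w ≤ c) (hcc : c < c') :
    ∃ δ > 0, δ ≤ r ∧ ∀ x ∈ Metric.ball x₀ δ, DifferentiableAt ℝ f x → DifferentiableAt ℝ g x →
      inner ℝ p (VectorField.lieBracket ℝ f g x) ≤ c' := by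
  by_contra hcon
  push Not at hcon
  have hseq : ∀ k : ℕ, ∃ x ∈ Metric.ball x₀ (min r (1 / ((k : ℝ) + 1))), DifferentiableAt ℝ f x ∧
      DifferentiableAt ℝ g x ∧ c' < inner ℝ p (VectorField.lieBracket ℝ f g x) := fun k =>
    hcon _ (lt_min hr (by positivity)) (min_le_left _ _)
  choose u hu hfu hgu hcu using hseq
  have hur : ∀ k, u k ∈ Metric.ball x₀ r := fun k =>
    Metric.ball_subset_ball (min_le_left _ _) (hu k)
  have hux : Tendsto u atTop (𝓝 x₀) := by
    rw [tendsto_iff_dist_tendsto_zero]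
    refine squeeze_zero (fun _ => dist_nonneg) (fun k => ?_) tendsto_one_div_add_atTop_nhds_zero_nat
    exact ((Metric.mem_ball.1 (hu k)).trans_le (min_le_right _ _)).le
  -- Boundedness of the brackets lets a sequence of violations accumulate at a limiting bracket at
  -- `x₀`, against `hc`.
  have hbd : ∀ k, VectorField.lieBracket ℝ f g (u k) ∈ Metric.closedBall (0 : State n)
      (2 * (K * M)) := fun k => by
    rw [mem_closedBall_zero_iff]
    exact norm_lieBracket_le (Metric.isOpen_ball.mem_nhds (hur k)) hf hg (hfM _ (hur k))
      (hgM _ (hur k))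
  obtain ⟨w, -, θ, hθ, hw⟩ := (isCompact_closedBall (0 : State n) (2 * (K * M))).tendsto_subseq hbd
  have hmem : w ∈ limitBrackets Ω f g x₀ :=
    ⟨u ∘ θ, fun k => ⟨hΩ (hur _), hfu _, hgu _⟩, hux.comp hθ.tendsto_atTop, hw⟩
  have h1 : c' ≤ inner ℝ p w := by
    refine ge_of_tendsto (tendsto_const_nhds.inner hw) (Eventually.of_forall fun k => ?_)
    exact (hcu (θ k)).le
  linarith [hc w hmem]

/-- If `⟨p,·⟩` is negative on the limiting Lie brackets at `x₀`, then the commutator of the flows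
decreases `⟨p,·⟩` at second order. -/
theorem exists_commutator_inner_le {Ω : Set (State n)} {f g F G : State n → State n}
    {x₀ p : State n} {r M c : ℝ} {K : NNReal} (hr : 0 < r) (hΩ : Metric.ball x₀ r ⊆ Ω)
    (hF : LipschitzWith K F) (hG : LipschitzWith K G) (hFM : ∀ x, ‖F x‖ ≤ M)
    (hGM : ∀ x, ‖G x‖ ≤ M) (hfF : EqOn F f (Metric.ball x₀ r)) (hgG : EqOn G g (Metric.ball x₀ r))
    (hc : ∀ w ∈ limitBrackets Ω f g x₀, inner ℝ p w ≤ c) (hc0 : c < 0)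
    {φ₁ φ₂ φ₃ φ₄ : State n → ℝ → State n} (h₁ : IsUnitFlow F φ₁)
    (h₂ : IsUnitFlow G φ₂) (h₃ : IsUnitFlow (fun x => -F x) φ₃)
    (h₄ : IsUnitFlow (fun x => -G x) φ₄) :
    ∀ᶠ t in 𝓝[>] (0 : ℝ),
      inner ℝ p (φ₄ (φ₃ (φ₂ (φ₁ x₀ t) t) t) t - x₀) ≤ c / 8 * t ^ 2 := by
  have hM : 0 ≤ M := (norm_nonneg _).trans (hFM x₀)
  have hK : (0:ℝ) ≤ K := K.2
  obtain ⟨δ, hδ, hδr, hbr⟩ := exists_forall_inner_lieBracket_le (K := K) (M := M)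
    (c' := c / 2) hr hΩ
    (LipschitzOnWith.of_dist_le_mul fun x hx z hz => by
      rw [← hfF hx, ← hfF hz]; exact hF.dist_le_mul x z)
    (LipschitzOnWith.of_dist_le_mul fun x hx z hz => by
      rw [← hgG hx, ← hgG hz]; exact hG.dist_le_mul x z)
    (fun x hx => by rw [← hfF hx]; exact hFM x) (fun x hx => by rw [← hgG hx]; exact hGM x)
    hc (by linarith)
  -- The constant `c` is halved three times: to `c/2` by passing to nearby points, to `c/4` by
  -- freezing the field values at `x₀`, to `c/8` by the third-order remainder. `L` measures the
  -- freezing error, and its `+ 1` keeps it positive.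
  set L : ℝ := ‖p‖ * (2 * (K * K)) + 1 with hL
  have hL0 : 0 < L := by positivity
  set δ' : ℝ := min δ (-c / 4 / L) with hδ'
  have hδ'0 : 0 < δ' := lt_min hδ (div_pos (by linarith) hL0)
  have hlip : ∀ {H : State n → State n}, LipschitzWith K H →
      LipschitzWith (‖p‖₊ * K) fun x => inner ℝ p (H x) := by
    intro H hH
    refine LipschitzWith.of_dist_le_mul fun x z => ?_
    rw [dist_eq_norm, ← inner_sub_right, NNReal.coe_mul, mul_assoc]
    refine (norm_inner_le_norm _ _).trans (mul_le_mul_of_nonneg_left ?_ (norm_nonneg _))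
    rw [← dist_eq_norm]
    exact hH.dist_le_mul x z
  have hcurl : ∀ᵐ x : State n, x ∈ Metric.ball x₀ δ' →
      fderiv ℝ (fun x => (inner ℝ p (G x) : ℝ)) x (F x₀)
        - fderiv ℝ (fun x => (inner ℝ p (F x) : ℝ)) x (G x₀) ≤ c / 4 := by
    filter_upwards [hF.ae_differentiableAt, hG.ae_differentiableAt] with x hFx hGx hx
    have hxδ : x ∈ Metric.ball x₀ δ := Metric.ball_subset_ball (min_le_left _ _) hx
    have hxr : x ∈ Metric.ball x₀ r := Metric.ball_subset_ball hδr hxδ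
    have hnhds := Metric.isOpen_ball.mem_nhds hxr
    have eF : F =ᶠ[𝓝 x] f := hfF.eventuallyEq_of_mem hnhds
    have eG : G =ᶠ[𝓝 x] g := hgG.eventuallyEq_of_mem hnhds
    have hb := hbr x hxδ (eF.differentiableAt_iff.1 hFx) (eG.differentiableAt_iff.1 hGx)
    rw [VectorField.lieBracket, ← eF.fderiv_eq, ← eG.fderiv_eq, ← hfF hxr, ← hgG hxr] at hb
    have dG : fderiv ℝ (fun x => (inner ℝ p (G x) : ℝ)) x (F x₀)
        = inner ℝ p (fderiv ℝ G x (F x₀)) := by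
      have := ((innerSL ℝ p).hasFDerivAt.comp x hGx.hasFDerivAt).fderiv
      exact congrArg (fun A => A (F x₀)) this
    have dF : fderiv ℝ (fun x => (inner ℝ p (F x) : ℝ)) x (G x₀)
        = inner ℝ p (fderiv ℝ F x (G x₀)) := by
      have := ((innerSL ℝ p).hasFDerivAt.comp x hFx.hasFDerivAt).fderiv
      exact congrArg (fun A => A (G x₀)) this
    rw [dG, dF, ← inner_sub_right]
    have hdist : ‖x₀ - x‖ ≤ δ' := by
      rw [← dist_eq_norm, dist_comm]; exact (Metric.mem_ball.1 hx).le
    have hFn : ‖fderiv ℝ F x (G x₀ - G x)‖ ≤ K * K * δ' := by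
      refine (ContinuousLinearMap.le_opNorm _ _).trans ?_
      rw [mul_assoc]
      refine mul_le_mul (norm_fderiv_le_of_lipschitz ℝ hF) ?_ (norm_nonneg _) hK
      exact (hG.norm_sub_le _ _).trans (mul_le_mul_of_nonneg_left hdist hK)
    have hGn : ‖fderiv ℝ G x (F x₀ - F x)‖ ≤ K * K * δ' := by
      refine (ContinuousLinearMap.le_opNorm _ _).trans ?_
      rw [mul_assoc]
      refine mul_le_mul (norm_fderiv_le_of_lipschitz ℝ hG) ?_ (norm_nonneg _) hK
      exact (hF.norm_sub_le _ _).trans (mul_le_mul_of_nonneg_left hdist hK)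
    have e : fderiv ℝ G x (F x₀) - fderiv ℝ F x (G x₀)
        = (fderiv ℝ G x (F x) - fderiv ℝ F x (G x))
          + (fderiv ℝ G x (F x₀ - F x) - fderiv ℝ F x (G x₀ - G x)) := by
      simp only [map_sub]; abel
    rw [e, inner_add_right]
    have h1 : inner ℝ p (fderiv ℝ G x (F x₀ - F x) - fderiv ℝ F x (G x₀ - G x))
        ≤ ‖p‖ * (2 * (K * K * δ')) := (real_inner_le_norm _ _).trans
      (mul_le_mul_of_nonneg_left ((norm_sub_le _ _).trans (by linarith)) (norm_nonneg _))
    have h2 : L * δ' ≤ -c / 4 := by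
      calc L * δ' ≤ L * (-c / 4 / L) := mul_le_mul_of_nonneg_left (min_le_right _ _) hL0.le
        _ = -c / 4 := by field_simp
    have h3 : L * δ' = ‖p‖ * (2 * (K * K * δ')) + δ' := by rw [hL]; ring
    linarith
  set D : ℝ := ‖p‖ * (20 * K ^ 2 * M) with hD
  have hD0 : 0 ≤ D := by positivity
  have hA : ∀ᶠ t in 𝓝[>] (0 : ℝ), t * (‖F x₀‖ + ‖G x₀‖) < δ' := by
    have : Tendsto (fun t : ℝ => t * (‖F x₀‖ + ‖G x₀‖)) (𝓝[>] 0) (𝓝 (0 * (‖F x₀‖ + ‖G x₀‖))) :=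
      ((continuous_id.mul continuous_const).tendsto 0).mono_left nhdsWithin_le_nhds
    rw [zero_mul] at this
    exact (tendsto_order.1 this).2 _ hδ'0
  have hB : ∀ᶠ t in 𝓝[>] (0 : ℝ), t * D < -c / 8 := by
    have : Tendsto (fun t : ℝ => t * D) (𝓝[>] 0) (𝓝 (0 * D)) :=
      ((continuous_id.mul continuous_const).tendsto 0).mono_left nhdsWithin_le_nhds
    rw [zero_mul] at this
    exact (tendsto_order.1 this).2 _ (by linarith)
  have hC : ∀ᶠ t in 𝓝[>] (0 : ℝ), t < 1 := nhdsWithin_le_nhds (gt_mem_nhds one_pos)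
  filter_upwards [hA, hB, hC, self_mem_nhdsWithin] with t ht1 ht2 ht3 ht0
  have ht0' : (0:ℝ) < t := ht0
  have hcomm := (norm_commutator_sub_le hF hG hFM hGM h₁ h₂ h₃ h₄ x₀ ⟨ht0'.le, ht3.le⟩).2
  have hcirc := circulation_le (hlip hF) (hlip hG) ht0'.le ht1 hcurl
  have hFc := hF.continuous
  have hGc := hG.continuous
  have c1 : Continuous fun r : ℝ => G (x₀ + t • F x₀ + r • G x₀) - G (x₀ + r • G x₀) :=
    (hGc.comp (by fun_prop)).sub (hGc.comp (by fun_prop))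
  have c2 : Continuous fun s : ℝ => F (x₀ + s • F x₀ + t • G x₀) - F (x₀ + s • F x₀) :=
    (hFc.comp (by fun_prop)).sub (hFc.comp (by fun_prop))
  have i1 := (innerSL ℝ p).intervalIntegral_comp_comm (c1.intervalIntegrable (μ := volume) 0 t)
  have i2 := (innerSL ℝ p).intervalIntegral_comp_comm (c2.intervalIntegrable (μ := volume) 0 t)
  simp only [innerSL_apply_apply, inner_sub_right] at i1 i2
  rw [i1, i2, ← inner_sub_right] at hcirc
  set W := (∫ r in (0:ℝ)..t, (G (x₀ + t • F x₀ + r • G x₀) - G (x₀ + r • G x₀)))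
        - ∫ s in (0:ℝ)..t, (F (x₀ + s • F x₀ + t • G x₀) - F (x₀ + s • F x₀))
  set Z := φ₄ (φ₃ (φ₂ (φ₁ x₀ t) t) t) t - x₀
  have e : Z = W + (Z - W) := by abel
  rw [e, inner_add_right]
  have h1 : inner ℝ p (Z - W) ≤ ‖p‖ * (20 * K ^ 2 * M * t ^ 3) :=
    (real_inner_le_norm _ _).trans (mul_le_mul_of_nonneg_left hcomm (norm_nonneg _))
  have h2 : ‖p‖ * (20 * K ^ 2 * M * t ^ 3) = (t * D) * t ^ 2 := by rw [hD]; ring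
  have h3 : (t * D) * t ^ 2 ≤ (-c / 8) * t ^ 2 := mul_le_mul_of_nonneg_right ht2.le (sq_nonneg t)
  linarith

end LieCLF

/-! ### Semiconcave functions and limiting gradients -/

namespace LieCLF

open MeasureTheory

variable {n : ℕ}

/-- Dyadic iteration of the midpoint form of semiconcavity. -/
theorem semiconcave_dyadic {U : State n → ℝ} {B : Set (State n)} (hB : Convex ℝ B) {ρ : ℝ}
    (hρ : ∀ z₁ ∈ B, ∀ z₂ ∈ B, U z₁ + U z₂ - 2 * U (midpoint ℝ z₁ z₂) ≤ ρ * ‖z₁ - z₂‖ ^ 2)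
    {u h : State n} (hu : u ∈ B) (huh : u + h ∈ B) (k : ℕ) :
    U (u + h) - U u ≤ 2 ^ k * (U (u + ((2:ℝ) ^ k)⁻¹ • h) - U u)
      + 2 * ρ * (1 - ((2:ℝ) ^ k)⁻¹) * ‖h‖ ^ 2 := by
  induction k with
  | zero => simp
  | succ k ih =>
    have h2k : (0:ℝ) < 2 ^ k := by positivity
    have hmem : u + ((2:ℝ) ^ k)⁻¹ • h ∈ B := by
      have := hB.add_smul_sub_mem hu huh (t := ((2:ℝ) ^ k)⁻¹)
        ⟨by positivity, inv_le_one_of_one_le₀ (one_le_pow₀ one_le_two)⟩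
      simpa using this
    -- Halving the increment `2⁻ᵏ h` and scaling by `2ᵏ` costs `ρ 2⁻ᵏ ‖h‖²`; these geometric costs
    -- sum to the stated factor.
    have hm := hρ _ hmem _ hu
    have emid : midpoint ℝ (u + ((2:ℝ) ^ k)⁻¹ • h) u = u + ((2:ℝ) ^ (k + 1))⁻¹ • h := by
      rw [midpoint_eq_smul_add, pow_succ, mul_inv]
      have : u + ((2:ℝ) ^ k)⁻¹ • h + u = (2:ℝ) • u + ((2:ℝ) ^ k)⁻¹ • h := by
        rw [two_smul]; abel
      rw [this, smul_add, smul_smul, smul_smul, mul_comm ((2:ℝ) ^ k)⁻¹]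
      simp
    have enorm : ‖u + ((2:ℝ) ^ k)⁻¹ • h - u‖ = ((2:ℝ) ^ k)⁻¹ * ‖h‖ := by
      rw [add_sub_cancel_left, norm_smul, Real.norm_of_nonneg (by positivity)]
    rw [emid, enorm] at hm
    have hmul := mul_le_mul_of_nonneg_left hm h2k.le
    have e1 : (2:ℝ) ^ k * (ρ * (((2:ℝ) ^ k)⁻¹ * ‖h‖) ^ 2) = ρ * ((2:ℝ) ^ k)⁻¹ * ‖h‖ ^ 2 := by
      field_simp
    have e2 : ((2:ℝ) ^ (k + 1))⁻¹ = ((2:ℝ) ^ k)⁻¹ / 2 := by rw [pow_succ, mul_inv]; ring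
    rw [e1] at hmul
    have e3 : 2 * ρ * (1 - ((2:ℝ) ^ (k + 1))⁻¹) * ‖h‖ ^ 2
        = 2 * ρ * (1 - ((2:ℝ) ^ k)⁻¹) * ‖h‖ ^ 2 + ρ * ((2:ℝ) ^ k)⁻¹ * ‖h‖ ^ 2 := by
      rw [e2]; ring
    rw [e3, pow_succ]
    rw [pow_succ] at hmul
    nlinarith

/-- At a point of differentiability the gradient is a proximal superdifferential. -/
theorem semiconcave_le_of_differentiableAt {U : State n → ℝ} {B : Set (State n)}
    (hB : Convex ℝ B) {ρ : ℝ} (hρ0 : 0 ≤ ρ)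
    (hρ : ∀ z₁ ∈ B, ∀ z₂ ∈ B, U z₁ + U z₂ - 2 * U (midpoint ℝ z₁ z₂) ≤ ρ * ‖z₁ - z₂‖ ^ 2)
    {u h : State n} (hu : u ∈ B) (huh : u + h ∈ B) (hd : DifferentiableAt ℝ U u) :
    U (u + h) ≤ U u + inner ℝ (gradient U u) h + 2 * ρ * ‖h‖ ^ 2 := by
  have hc : Tendsto (fun k : ℕ => ‖(2:ℝ) ^ k‖) atTop atTop := by
    simpa using tendsto_pow_atTop_atTop_of_one_lt (one_lt_two : (1:ℝ) < 2)
  have hlim := hd.hasFDerivAt.lim h (c := fun k : ℕ => (2:ℝ) ^ k) hc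
  have hg : inner ℝ (gradient U u) h = fderiv ℝ U u h := by
    rw [gradient, InnerProductSpace.toDual_symm_apply]
  rw [hg]
  have hle : U (u + h) - U u - 2 * ρ * ‖h‖ ^ 2 ≤ fderiv ℝ U u h := by
    refine ge_of_tendsto hlim (Eventually.of_forall fun k => ?_)
    have h1 := semiconcave_dyadic hB hρ hu huh k
    have h2 : 2 * ρ * (1 - ((2:ℝ) ^ k)⁻¹) * ‖h‖ ^ 2 ≤ 2 * ρ * ‖h‖ ^ 2 := by
      have : 0 ≤ 2 * ρ * ((2:ℝ) ^ k)⁻¹ * ‖h‖ ^ 2 := by positivity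
      linarith
    simp only [smul_eq_mul]
    linarith
  linarith

/-- A limiting gradient of a semiconcave function is a proximal superdifferential. -/
theorem semiconcave_le_of_mem_limitingGradients {Ω : Set (State n)} {U : State n → ℝ}
    {x₀ p : State n} {R : ℝ} (hR : 0 < R) {ρ : ℝ} (hρ0 : 0 ≤ ρ)
    (hU : ContinuousOn U (Metric.ball x₀ R))
    (hρ : ∀ z₁ ∈ Metric.ball x₀ R, ∀ z₂ ∈ Metric.ball x₀ R,
      U z₁ + U z₂ - 2 * U (midpoint ℝ z₁ z₂) ≤ ρ * ‖z₁ - z₂‖ ^ 2)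
    (hp : p ∈ limitingGradients Ω U x₀) {h : State n} (hh : ‖h‖ < R) :
    U (x₀ + h) ≤ U x₀ + inner ℝ p h + 2 * ρ * ‖h‖ ^ 2 := by
  obtain ⟨u, hu, hux, hup⟩ := hp
  have hx0 : x₀ ∈ Metric.ball x₀ R := Metric.mem_ball_self hR
  have hxh : x₀ + h ∈ Metric.ball x₀ R := by simpa using hh
  have huxh : Tendsto (fun k => u k + h) atTop (𝓝 (x₀ + h)) := hux.add_const h
  have c0 := (hU.continuousAt (Metric.isOpen_ball.mem_nhds hx0)).tendsto.comp hux
  have c1 := (hU.continuousAt (Metric.isOpen_ball.mem_nhds hxh)).tendsto.comp huxh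
  refine le_of_tendsto_of_tendsto c1
    ((c0.add (hup.inner tendsto_const_nhds)).add tendsto_const_nhds) ?_
  filter_upwards [hux (Metric.isOpen_ball.mem_nhds hx0), huxh (Metric.isOpen_ball.mem_nhds hxh)]
    with k hk hkh
  exact semiconcave_le_of_differentiableAt (convex_ball x₀ R) hρ0 hρ hk hkh (hu k).2.1

/-- Bounded semiconcave functions are locally Lipschitz continuous. -/
theorem semiconcave_lipschitzOnWith {U : State n → ℝ} {x₀ : State n} {R b ρ : ℝ} (hR : 0 < R)
    (hρ0 : 0 ≤ ρ) (hb : ∀ x ∈ Metric.ball x₀ R, |U x| ≤ b)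
    (hρ : ∀ z₁ ∈ Metric.ball x₀ R, ∀ z₂ ∈ Metric.ball x₀ R,
      U z₁ + U z₂ - 2 * U (midpoint ℝ z₁ z₂) ≤ ρ * ‖z₁ - z₂‖ ^ 2) :
    ∃ C : NNReal, LipschitzOnWith C U (Metric.ball x₀ (R / 4)) := by
  have hb0 : 0 ≤ b := (abs_nonneg _).trans (hb x₀ (Metric.mem_ball_self hR))
  set C : ℝ := (2 * b + 2 * ρ * (R / 2) ^ 2) * (4 / R) with hC
  have hC0 : 0 ≤ C := by positivity
  refine ⟨C.toNNReal, LipschitzOnWith.of_le_add_mul _ fun u hu w hw => ?_⟩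
  rw [Real.coe_toNNReal _ hC0]
  rcases eq_or_ne u w with rfl | hne
  · simp
  have hd : 0 < ‖w - u‖ := norm_pos_iff.2 (sub_ne_zero.2 hne.symm)
  rw [Metric.mem_ball, dist_eq_norm] at hu hw
  have hd2 : ‖w - u‖ < R / 2 := by
    have e : w - u = (w - x₀) - (u - x₀) := by abel
    rw [e]; exact (norm_sub_le _ _).trans_lt (by linarith)
  -- `w - u` is doubled until its length lies between `R/4` and `R/2`. At that scale the bound on
  -- `U` is as good as a Lipschitz bound, and the dyadic estimate brings it back down.
  obtain ⟨k, hk1, hk2⟩ := exists_nat_pow_near (x := R / 2 / ‖w - u‖) (y := (2:ℝ))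
    ((one_le_div hd).2 hd2.le) one_lt_two
  rw [le_div_iff₀ hd] at hk1
  rw [div_lt_iff₀ hd] at hk2
  have h2k : (0:ℝ) < 2 ^ k := by positivity
  set h : State n := (2:ℝ) ^ k • (w - u) with hh
  have hn : ‖h‖ ≤ R / 2 := by rwa [hh, norm_smul, Real.norm_of_nonneg h2k.le]
  have huB : u ∈ Metric.ball x₀ R := by rw [Metric.mem_ball, dist_eq_norm]; linarith
  have huh : u + h ∈ Metric.ball x₀ R := by
    rw [Metric.mem_ball, dist_eq_norm]
    have e : u + h - x₀ = (u - x₀) + h := by abel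
    rw [e]; exact (norm_add_le _ _).trans_lt (by linarith)
  have hs := semiconcave_dyadic (convex_ball x₀ R) hρ huB huh k
  have ew : u + ((2:ℝ) ^ k)⁻¹ • h = w := by
    rw [hh, smul_smul, inv_mul_cancel₀ h2k.ne', one_smul]; abel
  rw [ew] at hs
  have h1 := abs_le.1 (hb _ huB)
  have h2 := abs_le.1 (hb _ huh)
  have h3 : 2 * ρ * (1 - ((2:ℝ) ^ k)⁻¹) * ‖h‖ ^ 2 ≤ 2 * ρ * (R / 2) ^ 2 := by
    have : ‖h‖ ^ 2 ≤ (R / 2) ^ 2 := pow_le_pow_left₀ (norm_nonneg _) hn 2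
    have h4 : 2 * ρ * (1 - ((2:ℝ) ^ k)⁻¹) ≤ 2 * ρ :=
      mul_le_of_le_one_right (by positivity) (by linarith [inv_pos.2 h2k])
    exact mul_le_mul h4 this (by positivity) (by positivity)
  have h5 : 2 ^ k * (U u - U w) ≤ 2 * b + 2 * ρ * (R / 2) ^ 2 := by linarith
  have h6 : 2 * b + 2 * ρ * (R / 2) ^ 2 ≤ 2 ^ k * (C * ‖w - u‖) := by
    have e : (2 * b + 2 * ρ * (R / 2) ^ 2) = C * (R / 4) := by rw [hC]; field_simp
    rw [e]
    rw [pow_succ] at hk2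
    nlinarith
  have h7 : U u - U w ≤ C * ‖w - u‖ := le_of_mul_le_mul_left (h5.trans h6) h2k
  rw [dist_comm, dist_eq_norm]
  linarith

/-- A locally Lipschitz function has limiting gradients. -/
theorem limitingGradients_nonempty [Nontrivial (State n)] {Ω : Set (State n)} {U : State n → ℝ}
    {x₀ : State n} {r : ℝ} (hr : 0 < r) (hΩ : Metric.ball x₀ r ⊆ Ω) {C : NNReal}
    (hU : LipschitzOnWith C U (Metric.ball x₀ r)) : (limitingGradients Ω U x₀).Nonempty := by
  obtain ⟨V, hV, hVU⟩ := hU.extend_real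
  -- Rademacher's theorem. Nontriviality makes `{x₀}` null, as needed for the sequence to avoid
  -- `x₀`.
  have hae : ∀ᵐ x : State n, DifferentiableAt ℝ V x ∧ x ≠ x₀ := by
    filter_upwards [hV.ae_differentiableAt, compl_mem_ae_iff.2 (measure_singleton x₀)]
      with x h1 h2 using ⟨h1, h2⟩
  have hdense := Measure.dense_of_ae hae
  have hseq : ∀ k : ℕ, ∃ x ∈ Metric.ball x₀ (min r (1 / ((k : ℝ) + 1))),
      DifferentiableAt ℝ V x ∧ x ≠ x₀ := by
    intro k
    obtain ⟨x, hx1, hx2⟩ := hdense.inter_open_nonempty _ Metric.isOpen_ball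
      ⟨x₀, Metric.mem_ball_self (lt_min hr (by positivity : (0:ℝ) < 1 / ((k : ℝ) + 1)))⟩
    exact ⟨x, hx1, hx2⟩
  choose u hu hud hux₀ using hseq
  have hur : ∀ k, u k ∈ Metric.ball x₀ r := fun k =>
    Metric.ball_subset_ball (min_le_left _ _) (hu k)
  have hux : Tendsto u atTop (𝓝 x₀) := by
    rw [tendsto_iff_dist_tendsto_zero]
    refine squeeze_zero (fun _ => dist_nonneg) (fun k => ?_) tendsto_one_div_add_atTop_nhds_zero_nat
    exact ((Metric.mem_ball.1 (hu k)).trans_le (min_le_right _ _)).le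
  have hdU : ∀ k, DifferentiableAt ℝ U (u k) := fun k =>
    (hVU.eventuallyEq_of_mem (Metric.isOpen_ball.mem_nhds (hur k))).differentiableAt_iff.2 (hud k)
  have hbd : ∀ k, gradient U (u k) ∈ Metric.closedBall (0 : State n) C := fun k => by
    rw [mem_closedBall_zero_iff, gradient, LinearIsometryEquiv.norm_map]
    exact norm_fderiv_le_of_lipschitzOn ℝ (Metric.isOpen_ball.mem_nhds (hur k)) hU
  obtain ⟨w, -, θ, hθ, hw⟩ := (isCompact_closedBall (0 : State n) C).tendsto_subseq hbd
  exact ⟨w, u ∘ θ, fun k => ⟨hΩ (hur _), hdU _, hux₀ _⟩, hux.comp hθ.tendsto_atTop, hw⟩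

/-- If the degree-2 Hamiltonian is negative, then one of the fields or one of the limiting brackets
points in a direction of decrease. -/
theorem exists_descent_of_hamiltonian2_neg {m : ℕ} {Ω : Set (State n)}
    {f : Fin m → State n → State n} {x p : State n}
    (hbd : ∀ i j, Bornology.IsBounded (limitBrackets Ω (f i) (f j) x))
    (hH : hamiltonian2 Ω f x p < 0) :
    (∃ a ∈ controlSet m, inner ℝ p (∑ i, a i • f i x) < 0) ∨
      ∃ i j, ∃ c < 0, ∀ w ∈ limitBrackets Ω (f i) (f j) x, inner ℝ p w ≤ c := by
  -- An empty family would give the default value `sInf ∅ = 0`, which is not negative.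
  have hne : ((fun v : Set (State n) => sSup ((fun w => inner ℝ p w) '' v)) ''
      family2 Ω f x).Nonempty := by
    by_contra hemp
    rw [not_nonempty_iff_eq_empty] at hemp
    rw [hamiltonian2, hemp, Real.sInf_empty] at hH
    exact lt_irrefl _ hH
  obtain ⟨_, ⟨v, hv, rfl⟩, hlt⟩ := exists_lt_of_csInf_lt hne hH
  rcases hv with ⟨l, rfl | rfl⟩ | ⟨i, j, rfl⟩
  · refine Or.inl ⟨Pi.single l 1, ⟨l, Or.inl rfl⟩, ?_⟩
    simpa [Pi.single_apply] using hlt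
  · refine Or.inl ⟨-Pi.single l 1, ⟨l, Or.inr rfl⟩, ?_⟩
    simpa [Pi.single_apply] using hlt
  · refine Or.inr ⟨i, j, _, hlt, fun w hw => ?_⟩
    -- Boundedness makes `sSup` a genuine upper bound instead of a default value.
    obtain ⟨C, hC⟩ := ((isBounded_convexHull (s := limitBrackets Ω (f i) (f j) x)).2
      (hbd i j)).exists_norm_le
    refine le_csSup ⟨‖p‖ * C, ?_⟩ ⟨w, subset_convexHull ℝ _ hw, rfl⟩
    rintro _ ⟨z, hz, rfl⟩
    exact (real_inner_le_norm _ _).trans (mul_le_mul_of_nonneg_left (hC z hz) (norm_nonneg _))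

end LieCLF

/-! ### Local descent for the control Lyapunov function -/

namespace LieCLF

variable {n m : ℕ}

/-- Near a point of the domain the fields coincide with bounded, globally Lipschitz fields. -/
theorem exists_global_extension {T : Set (State n)} (hT : IsClosed T)
    {f : Fin m → State n → State n}
    (hf : ∀ Ω : Set (State n), IsOpen Ω → Bornology.IsBounded Ω → ∀ i, IsCb01On (f i) (Ω \ T))
    {x₀ : State n} (hx₀ : x₀ ∈ Tᶜ) {ε : ℝ} (hε : 0 < ε) :
    ∃ R > 0, R ≤ ε ∧ Metric.closedBall x₀ R ⊆ Tᶜ ∧ ∃ (K : NNReal) (M : ℝ)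
      (F : Fin m → State n → State n), 0 ≤ M ∧ ∀ i, LipschitzWith K (F i) ∧ (∀ x, ‖F i x‖ ≤ M) ∧
        EqOn (F i) (f i) (Metric.ball x₀ R) := by
  obtain ⟨R', hR', hball⟩ := Metric.nhds_basis_closedBall.mem_iff.1 (hT.isOpen_compl.mem_nhds hx₀)
  set R := min R' ε with hR
  have hR0 : 0 < R := lt_min hR' hε
  have hsub : Metric.closedBall x₀ R ⊆ Tᶜ :=
    (Metric.closedBall_subset_closedBall (min_le_left _ _)).trans hball
  -- Composing with the projection onto a closed ball inside the domain extends the fields without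
  -- increasing their Lipschitz constants.
  obtain ⟨P, hP, hPm, hPid⟩ := exists_nonexpansive_retraction
    (C := Metric.closedBall x₀ R) ⟨x₀, Metric.mem_closedBall_self hR0.le⟩
    Metric.isClosed_closedBall.isComplete (convex_closedBall x₀ R)
  have hCb := hf (Metric.ball x₀ (R + 1)) Metric.isOpen_ball Metric.isBounded_ball
  choose hM hK using hCb
  choose M hM using hM
  choose K hK using hK
  have hmem : Metric.closedBall x₀ R ⊆ Metric.ball x₀ (R + 1) \ T := fun x hx =>
    ⟨Metric.closedBall_subset_ball (by linarith) hx, hsub hx⟩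
  refine ⟨R, hR0, min_le_right _ _, hsub, ∑ i, K i, ∑ i, |M i|, fun i x => f i (P x),
    Finset.sum_nonneg fun i _ => abs_nonneg _, fun i => ⟨?_, fun x => ?_, fun x hx => ?_⟩⟩
  · have h1 : LipschitzOnWith (∑ i, K i) (f i) (Metric.closedBall x₀ R) :=
      ((hK i).mono hmem).weaken (Finset.single_le_sum (f := K) (fun _ _ => zero_le) (by simp))
    refine LipschitzWith.of_dist_le_mul fun x z => ?_
    refine (h1.dist_le_mul _ (hPm x) _ (hPm z)).trans (mul_le_mul_of_nonneg_left ?_ NNReal.zero_le_coe)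
    simpa using hP.dist_le_mul x z
  · exact ((hM i _ (hmem (hPm x))).trans (le_abs_self _)).trans
      (Finset.single_le_sum (f := fun i => |M i|) (fun _ _ => abs_nonneg _) (by simp))
  · exact congrArg (f i) (hPid x (Metric.ball_subset_closedBall hx))

theorem isBounded_limitBrackets {Ω : Set (State n)} {f g : State n → State n} {x₀ : State n}
    {s : Set (State n)} (hs : s ∈ 𝓝 x₀) {K : NNReal} {M : ℝ} (hf : LipschitzOnWith K f s)
    (hg : LipschitzOnWith K g s) (hfM : ∀ x ∈ s, ‖f x‖ ≤ M) (hgM : ∀ x ∈ s, ‖g x‖ ≤ M) :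
    Bornology.IsBounded (limitBrackets Ω f g x₀) := by
  rw [isBounded_iff_forall_norm_le]
  refine ⟨2 * (K * M), ?_⟩
  rintro w ⟨u, -, hux, hw⟩
  refine le_of_tendsto hw.norm ?_
  filter_upwards [hux.eventually (eventually_mem_nhds_iff.2 hs)] with k hk
  exact norm_lieBracket_le hk hf hg (hfM _ (mem_of_mem_nhds hk)) (hgM _ (mem_of_mem_nhds hk))

/-- Speed at most `M` keeps the curve in the ball where the extended field agrees with the original
one. -/
theorem IsUnitFlow.steers_ball {f : Fin m → State n → State n} {G : State n → State n}
    {φ : State n → ℝ → State n} (h : IsUnitFlow G φ) {M : ℝ} (hM : ∀ x, ‖G x‖ ≤ M)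
    {a : Fin m → ℝ} (ha : a ∈ controlSet m) {x₀ : State n} {R : ℝ}
    (hG : ∀ v ∈ Metric.ball x₀ R, G v = ∑ i, a i • f i v) {x : State n} {d t : ℝ}
    (ht : t ∈ Icc (0 : ℝ) 1) (hd : ‖x - x₀‖ ≤ d) (hR : d + M * t < R) :
    Steers f (Metric.ball x₀ R) x (φ x t) t ∧ ‖φ x t - x₀‖ ≤ d + M * t := by
  have hM0 : 0 ≤ M := (norm_nonneg _).trans (hM x)
  have hle : ∀ s ∈ Icc 0 t, ‖φ x s - x₀‖ ≤ d + M * t := by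
    intro s hs
    have h1 := h.norm_sub_le hM x (t := s) ⟨hs.1, hs.2.trans ht.2⟩
    have h2 : M * s ≤ M * t := mul_le_mul_of_nonneg_left hs.2 hM0
    have e : φ x s - x₀ = (φ x s - x) + (x - x₀) := by abel
    rw [e]; exact (norm_add_le _ _).trans (by linarith)
  refine ⟨h.steers ha hG ht.2 fun s hs => ?_, hle t ⟨ht.1, le_rfl⟩⟩
  rw [Metric.mem_ball, dist_eq_norm]
  exact (hle s hs).trans_lt hR

theorem eventually_mul_lt (A : ℝ) {b : ℝ} (hb : 0 < b) : ∀ᶠ t in 𝓝[>] (0 : ℝ), A * t < b := by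
  have : Tendsto (fun t : ℝ => A * t) (𝓝[>] 0) (𝓝 (A * 0)) :=
    ((continuous_const.mul continuous_id).tendsto 0).mono_left nhdsWithin_le_nhds
  rw [mul_zero] at this
  exact (tendsto_order.1 this).2 _ hb

/-- Near every point of the domain there is a piecewise constant control word which decreases a
degree-2 control Lyapunov function; its end point depends continuously on the initial point. -/
theorem IsDegreeTwoCLF.exists_local_descent {T : Set (State n)} (hT : IsClosed T)
    (hTne : T.Nonempty) {f : Fin m → State n → State n}
    (hf : ∀ Ω : Set (State n), IsOpen Ω → Bornology.IsBounded Ω → ∀ i, IsCb01On (f i) (Ω \ T))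
    {U : State n → ℝ} (hU : IsDegreeTwoCLF f T U) {x₀ : State n} (hx₀ : x₀ ∈ Tᶜ) {ε : ℝ}
    (hε : 0 < ε) :
    ∃ (e : State n → State n) (τ : ℝ), 0 < τ ∧ Continuous e ∧ U (e x₀) < U x₀ ∧
      ∀ᶠ x in 𝓝 x₀, Steers f (Tᶜ ∩ Metric.ball x₀ ε) x (e x) τ := by
  obtain ⟨R, hR, hRε, hRT, K, M, F, hM, hF⟩ := exists_global_extension hT hf hx₀ hε
  have hbT : Metric.ball x₀ R ⊆ Tᶜ := Metric.ball_subset_closedBall.trans hRT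
  have hbV : Metric.ball x₀ R ⊆ Tᶜ ∩ Metric.ball x₀ ε :=
    subset_inter hbT (Metric.ball_subset_ball hRε)
  obtain ⟨hUc, ρ, hρ0, hρ⟩ := hU.locallySemiconcave _ hRT (isCompact_closedBall x₀ R)
  have hρ' : ∀ z₁ ∈ Metric.ball x₀ R, ∀ z₂ ∈ Metric.ball x₀ R,
      U z₁ + U z₂ - 2 * U (midpoint ℝ z₁ z₂) ≤ ρ * ‖z₁ - z₂‖ ^ 2 := fun z₁ h₁ z₂ h₂ =>
    hρ z₁ (Metric.ball_subset_closedBall h₁) z₂ (Metric.ball_subset_closedBall h₂)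
      ((convex_closedBall x₀ R).segment_subset (Metric.ball_subset_closedBall h₁)
        (Metric.ball_subset_closedBall h₂))
  have hUb := hUc.mono (Metric.ball_subset_closedBall (x := x₀) (ε := R))
  obtain ⟨b, hb⟩ := (isCompact_closedBall x₀ R).exists_bound_of_continuousOn hUc
  obtain ⟨C, hC⟩ := semiconcave_lipschitzOnWith hR hρ0.le
    (fun x hx => hb x (Metric.ball_subset_closedBall hx)) hρ'
  obtain ⟨z, hz⟩ := hTne
  have hnt : Nontrivial (State n) := ⟨x₀, z, fun h => hx₀ (h ▸ hz)⟩
  obtain ⟨p, hp⟩ := limitingGradients_nonempty (Ω := Tᶜ) (by positivity : 0 < R / 4)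
    ((Metric.ball_subset_ball (by linarith)).trans hbT) hC
  have hsup := fun (h : State n) (hh : ‖h‖ < R) =>
    semiconcave_le_of_mem_limitingGradients hR hρ0.le hUb hρ' hp (h := h) hh
  have hfl : ∀ i, LipschitzOnWith K (f i) (Metric.ball x₀ R) := fun i =>
    LipschitzOnWith.of_dist_le_mul fun x hx z hz => by
      rw [← (hF i).2.2 hx, ← (hF i).2.2 hz]; exact (hF i).1.dist_le_mul x z
  have hfM : ∀ i, ∀ x ∈ Metric.ball x₀ R, ‖f i x‖ ≤ M := fun i x hx => by
    rw [← (hF i).2.2 hx]; exact (hF i).2.1 x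
  have hx0 : x₀ ∈ Metric.ball x₀ R := Metric.mem_ball_self hR
  have hnear : ∀ᶠ x in 𝓝 x₀, ‖x - x₀‖ ≤ R / 2 := by
    filter_upwards [Metric.closedBall_mem_nhds x₀ (half_pos hR)] with x hx
    rwa [Metric.mem_closedBall, dist_eq_norm] at hx
  -- Room for four legs started in the half ball.
  have hsmall : ∀ᶠ t in 𝓝[>] (0:ℝ), t ∈ Ioc (0:ℝ) 1 ∧ R / 2 + M * t + M * t + M * t + M * t < R := by
    filter_upwards [self_mem_nhdsWithin, eventually_mul_lt 1 one_pos,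
      eventually_mul_lt (4 * M) (half_pos hR)] with t h1 h2 h3
    exact ⟨⟨h1, by linarith⟩, by linarith⟩
  rcases exists_descent_of_hamiltonian2_neg (fun i j => isBounded_limitBrackets
    (Metric.ball_mem_nhds x₀ hR) (hfl i) (hfl j) (hfM i) (hfM j)) (hU.decrease x₀ hx₀ p hp)
    with ⟨a, ha, hc⟩ | ⟨i, j, c, hc, hw⟩
  · obtain ⟨G, hGlip, hGM, hGf⟩ : ∃ G : State n → State n, LipschitzWith K G ∧
        (∀ x, ‖G x‖ ≤ M) ∧ ∀ v ∈ Metric.ball x₀ R, G v = ∑ i, a i • f i v := by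
      obtain ⟨l, rfl | rfl⟩ := ha
      · refine ⟨F l, (hF l).1, (hF l).2.1, fun v hv => ?_⟩
        simp [Pi.single_apply, (hF l).2.2 hv]
      · refine ⟨fun x => -F l x, (hF l).1.neg, fun x => by
          rw [norm_neg]; exact (hF l).2.1 x, fun v hv => ?_⟩
        simp [Pi.single_apply, (hF l).2.2 hv]
    obtain ⟨φ, hφ⟩ := exists_isUnitFlow hGlip hGM
    rw [← hGf x₀ hx0] at hc
    obtain ⟨t, ⟨ht, htR⟩, htc⟩ := (hsmall.and (eventually_mul_lt (‖p‖ * (K * M) + 2 * ρ * M ^ 2)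
      (neg_pos.2 hc))).exists
    have ht1 : t ∈ Icc (0:ℝ) 1 := ⟨ht.1.le, ht.2⟩
    have hMt : 0 ≤ M * t := mul_nonneg hM ht.1.le
    refine ⟨fun x => φ x t, t, ht.1, hφ.continuous_apply hGlip ht1, ?_, ?_⟩
    · have h1 : ‖φ x₀ t - x₀‖ ≤ M * t := hφ.norm_sub_le hGM x₀ ht1
      have h2 := hφ.norm_sub_affine_le hGlip hGM (x := x₀) (x₀ := x₀) (a := x₀) (d := 0) (e := 0)
        ht1 (by simp) (by simp) (s := t) ⟨ht.1.le, le_rfl⟩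
      have h3 := hsup (φ x₀ t - x₀) (h1.trans_lt (by linarith))
      have e1 : x₀ + (φ x₀ t - x₀) = φ x₀ t := by abel
      have e2 : φ x₀ t - x₀ = t • G x₀ + (φ x₀ t - (x₀ + t • G x₀)) := by abel
      have h4 : inner ℝ p (φ x₀ t - x₀) ≤ t * inner ℝ p (G x₀) + ‖p‖ * (K * (M * t) * t) := by
        rw [e2, inner_add_right, inner_smul_right]
        have h5 := (real_inner_le_norm p (φ x₀ t - (x₀ + t • G x₀))).trans
          (mul_le_mul_of_nonneg_left h2 (norm_nonneg p))
        simp only [zero_add] at h5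
        linarith
      have h6 : ‖φ x₀ t - x₀‖ ^ 2 ≤ (M * t) ^ 2 := pow_le_pow_left₀ (norm_nonneg _) h1 2
      have h7 : 2 * ρ * ‖φ x₀ t - x₀‖ ^ 2 ≤ 2 * ρ * (M * t) ^ 2 :=
        mul_le_mul_of_nonneg_left h6 (by positivity)
      rw [e1] at h3
      have h8 := mul_lt_mul_of_pos_left htc ht.1
      simp only
      linarith
    · filter_upwards [hnear] with x hx
      exact (hφ.steers_ball hGM ha hGf ht1 hx (by linarith)).1.mono hbV
  · have hni : ∀ (i : Fin m) (x : State n), ‖-F i x‖ ≤ M := fun i x => by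
      rw [norm_neg]; exact (hF i).2.1 x
    obtain ⟨φ₁, h₁⟩ := exists_isUnitFlow (hF i).1 (hF i).2.1
    obtain ⟨φ₂, h₂⟩ := exists_isUnitFlow (hF j).1 (hF j).2.1
    obtain ⟨φ₃, h₃⟩ := exists_isUnitFlow (hF i).1.neg (hni i)
    obtain ⟨φ₄, h₄⟩ := exists_isUnitFlow (hF j).1.neg (hni j)
    -- The gain is of order `t²`. The semiconcavity error is quadratic in a displacement of size `10
    -- K M t²`, hence of order `t⁴`, and loses for small `t`.
    have hcomm := exists_commutator_inner_le hR hbT (hF i).1 (hF j).1 (hF i).2.1 (hF j).2.1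
      (hF i).2.2 (hF j).2.2 hw hc h₁ h₂ h₃ h₄
    obtain ⟨t, ⟨⟨⟨ht, htR⟩, hte⟩, htc⟩, htd⟩ := (((hsmall.and hcomm).and
      (eventually_mul_lt (2 * ρ * (10 * K * M) ^ 2) (by linarith : 0 < -c / 8))).and
      (eventually_mul_lt (10 * K * M) hR)).exists
    have ht1 : t ∈ Icc (0:ℝ) 1 := ⟨ht.1.le, ht.2⟩
    have hMt : 0 ≤ M * t := mul_nonneg hM ht.1.le
    have ht0 := ht.1
    have hK : (0:ℝ) ≤ K := K.2
    refine ⟨fun x => φ₄ (φ₃ (φ₂ (φ₁ x t) t) t) t, t + t + t + t, by linarith, ?_, ?_, ?_⟩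
    · exact (h₄.continuous_apply (hF j).1.neg ht1).comp
        ((h₃.continuous_apply (hF i).1.neg ht1).comp
          ((h₂.continuous_apply (hF j).1 ht1).comp (h₁.continuous_apply (hF i).1 ht1)))
    · have h1 := (norm_commutator_sub_le (hF i).1 (hF j).1 (hF i).2.1 (hF j).2.1 h₁ h₂ h₃ h₄ x₀
        ht1).1
      simp only
      set x₄ := φ₄ (φ₃ (φ₂ (φ₁ x₀ t) t) t) t
      have hsq : t ^ 2 ≤ t := by nlinarith [ht.2]
      have hKM : 0 ≤ 10 * K * M := by positivity
      have h3 := hsup (x₄ - x₀) (h1.trans_lt ((mul_le_mul_of_nonneg_left hsq hKM).trans_lt htd))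
      have e1 : x₀ + (x₄ - x₀) = x₄ := by abel
      rw [e1] at h3
      have h6 : ‖x₄ - x₀‖ ^ 2 ≤ (10 * K * M * t ^ 2) ^ 2 := pow_le_pow_left₀ (norm_nonneg _) h1 2
      have h7 : 2 * ρ * ‖x₄ - x₀‖ ^ 2 ≤ 2 * ρ * (10 * K * M * t ^ 2) ^ 2 :=
        mul_le_mul_of_nonneg_left h6 (by positivity)
      have h8 : 2 * ρ * (10 * K * M * t ^ 2) ^ 2 ≤ (2 * ρ * (10 * K * M) ^ 2 * t) * t ^ 2 := by
        have e : 2 * ρ * (10 * K * M * t ^ 2) ^ 2 = (2 * ρ * (10 * K * M) ^ 2 * t ^ 2) * t ^ 2 := by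
          ring
        rw [e]
        exact mul_le_mul_of_nonneg_right (mul_le_mul_of_nonneg_left hsq (by positivity))
          (sq_nonneg t)
      have h9 := mul_lt_mul_of_pos_right htc (by positivity : 0 < t ^ 2)
      linarith
    · filter_upwards [hnear] with x hx
      have hs : ∀ (l : Fin m), ∀ v ∈ Metric.ball x₀ R,
          F l v = ∑ i, (Pi.single l 1 : Fin m → ℝ) i • f i v := fun l v hv => by
        simp [Pi.single_apply, (hF l).2.2 hv]
      have hs' : ∀ (l : Fin m), ∀ v ∈ Metric.ball x₀ R,
          -F l v = ∑ i, (-Pi.single l 1 : Fin m → ℝ) i • f i v := fun l v hv => by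
        simp [Pi.single_apply, (hF l).2.2 hv]
      obtain ⟨s1, d1⟩ := h₁.steers_ball (hF i).2.1 ⟨i, Or.inl rfl⟩ (hs i) ht1 hx (by linarith)
      obtain ⟨s2, d2⟩ := h₂.steers_ball (hF j).2.1 ⟨j, Or.inl rfl⟩ (hs j) ht1 d1 (by linarith)
      obtain ⟨s3, d3⟩ := h₃.steers_ball (hni i) ⟨i, Or.inr rfl⟩ (hs' i) ht1 d2 (by linarith)
      obtain ⟨s4, -⟩ := h₄.steers_ball (hni j) ⟨j, Or.inr rfl⟩ (hs' j) ht1 d3 (by linarith)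
      exact ((((s1.trans ht0.le ht0.le s2).trans (by linarith) ht0.le s3).trans (by linarith)
        ht0.le s4)).mono hbV

end LieCLF

/-! ### Uniform descent, halving, and comparison of `U` with the distance -/

namespace LieCLF

variable {n m : ℕ} {T : Set (State n)} {f : Fin m → State n → State n} {U : State n → ℝ}

namespace IsDegreeTwoCLF

theorem mem_compl (hU : IsDegreeTwoCLF f T U) {x : State n} (hx : x ∈ closure Tᶜ)
    (h : 0 < U x) : x ∈ Tᶜ := by
  by_contra hcon
  refine h.ne' (hU.zero x ?_)
  rw [frontier_eq_closure_inter_closure]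
  exact ⟨subset_closure (not_not.1 hcon), hx⟩

theorem continuousAt (hU : IsDegreeTwoCLF f T U) (hT : IsClosed T) {x : State n} (hx : x ∈ Tᶜ) :
    ContinuousAt U x :=
  hU.continuousOn.continuousAt (mem_of_superset (hT.isOpen_compl.mem_nhds hx) subset_closure)

/-- Uniform decrease on a neighbourhood, with small overshoot. -/
theorem exists_descent_nhds (hT : IsClosed T) (hTne : T.Nonempty)
    (hf : ∀ Ω : Set (State n), IsOpen Ω → Bornology.IsBounded Ω → ∀ i, IsCb01On (f i) (Ω \ T))
    (hU : IsDegreeTwoCLF f T U) {x₀ : State n} (hx₀ : x₀ ∈ Tᶜ) {ε : ℝ} (hε : 0 < ε) :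
    ∃ η > 0, ∃ τ > 0, ∀ᶠ x in 𝓝 x₀, ∃ z,
      Steers f {v | v ∈ Tᶜ ∧ U v ≤ U x + ε} x z τ ∧ U z ≤ U x - η := by
  have hc := hU.continuousAt hT hx₀
  obtain ⟨δ, hδ, hball⟩ := Metric.mem_nhds_iff.1 (hc.eventually (gt_mem_nhds
    (by linarith : U x₀ < U x₀ + ε / 2)))
  obtain ⟨e, τ, hτ, hec, hdec, hst⟩ := hU.exists_local_descent hT hTne hf hx₀ hδ
  have hexT : e x₀ ∈ Tᶜ := (hst.self_of_nhds.end_mem hτ.le).1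
  -- One third of the drop absorbs the variation of `U` at the start, one third that at the end, and
  -- one third remains.
  set η := (U x₀ - U (e x₀)) / 3 with hη
  have hη0 : 0 < η := by rw [hη]; linarith
  have hce : ContinuousAt (fun x => U (e x)) x₀ :=
    ContinuousAt.comp (hU.continuousAt hT hexT) hec.continuousAt
  refine ⟨η, hη0, τ, hτ, ?_⟩
  filter_upwards [hst, hce.eventually (gt_mem_nhds (by linarith : U (e x₀) < U (e x₀) + η)),
    hc.eventually (lt_mem_nhds (by linarith : U x₀ - η < U x₀)),
    hc.eventually (lt_mem_nhds (by linarith : U x₀ - ε / 2 < U x₀))] with x h1 h2 h3 h4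
  refine ⟨e x, h1.mono fun v hv => ⟨hv.1, ?_⟩, by linarith⟩
  have : U v < U x₀ + ε / 2 := hball hv.2
  linarith

/-- Uniform decrease on compact subsets of the domain. -/
theorem exists_descent_compact (hT : IsClosed T) (hTne : T.Nonempty)
    (hf : ∀ Ω : Set (State n), IsOpen Ω → Bornology.IsBounded Ω → ∀ i, IsCb01On (f i) (Ω \ T))
    (hU : IsDegreeTwoCLF f T U) {C : Set (State n)} (hC : IsCompact C) (hCT : C ⊆ Tᶜ) {ε : ℝ}
    (hε : 0 < ε) :
    ∃ η > 0, ∃ Θ : ℝ, ∀ x ∈ C, ∃ τ z, 0 < τ ∧ τ ≤ Θ ∧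
      Steers f {v | v ∈ Tᶜ ∧ U v ≤ U x + ε} x z τ ∧ U z ≤ U x - η := by
  refine hC.induction_on (p := fun C => ∃ η > 0, ∃ Θ : ℝ, ∀ x ∈ C, ∃ τ z, 0 < τ ∧ τ ≤ Θ ∧
      Steers f {v | v ∈ Tᶜ ∧ U v ≤ U x + ε} x z τ ∧ U z ≤ U x - η)
    ⟨1, one_pos, 0, by simp⟩ ?_ ?_ ?_
  · rintro s t hst ⟨η, hη, Θ, h⟩
    exact ⟨η, hη, Θ, fun x hx => h x (hst hx)⟩
  · rintro s t ⟨η, hη, Θ, h⟩ ⟨η', hη', Θ', h'⟩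
    refine ⟨min η η', lt_min hη hη', max Θ Θ', fun x hx => ?_⟩
    rcases hx with hx | hx
    · obtain ⟨τ, z, h1, h2, h3, h4⟩ := h x hx
      exact ⟨τ, z, h1, h2.trans (le_max_left _ _), h3, by linarith [min_le_left η η']⟩
    · obtain ⟨τ, z, h1, h2, h3, h4⟩ := h' x hx
      exact ⟨τ, z, h1, h2.trans (le_max_right _ _), h3, by linarith [min_le_right η η']⟩
  · intro x hx
    obtain ⟨η, hη, τ, hτ, h⟩ := hU.exists_descent_nhds hT hTne hf (hCT hx) hε
    refine ⟨_, mem_nhdsWithin_of_mem_nhds h, η, hη, τ, fun z hz => ?_⟩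
    obtain ⟨w, h1, h2⟩ := hz
    exact ⟨τ, w, hτ, le_rfl, h1, h2⟩

/-- Between two levels the function can be halved in uniformly bounded time, with controlled
overshoot. -/
theorem exists_halving (hT : IsClosed T) (hTne : T.Nonempty)
    (hf : ∀ Ω : Set (State n), IsOpen Ω → Bornology.IsBounded Ω → ∀ i, IsCb01On (f i) (Ω \ T))
    (hU : IsDegreeTwoCLF f T U) {a b : ℝ} (ha : 0 < a) :
    ∃ Θ : ℝ, ∀ x ∈ Tᶜ, a ≤ U x → U x ≤ b → ∃ τ z, 0 < τ ∧ τ ≤ Θ ∧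
      Steers f {v | v ∈ Tᶜ ∧ U v ≤ 2 * U x} x z τ ∧ U z ≤ U x / 2 := by
  have hCc : IsCompact (closure Tᶜ ∩ U ⁻¹' Icc (a / 2) b) :=
    hU.proper _ (fun r hr => le_trans (by positivity) hr.1) isCompact_Icc
  obtain ⟨η, hη, Θ, hstep⟩ := hU.exists_descent_compact hT hTne hf hCc
    (fun x hx => hU.mem_compl hx.1 (lt_of_lt_of_le (by positivity) hx.2.1)) ha
  -- Here `k` counts decrements `η` above the target level `l`; one extra step covers `k = 0`. Each
  -- step starts lower than the last, so overshoots do not accumulate. Finally `U x + a ≤ 2 U x`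
  -- because `a ≤ U x`.
  have key : ∀ (k : ℕ) (l : ℝ), a / 2 ≤ l → ∀ x ∈ Tᶜ, l ≤ U x → U x ≤ b → U x ≤ l + k * η →
      ∃ τ z, 0 < τ ∧ τ ≤ (k + 1) * |Θ| ∧
        Steers f {v | v ∈ Tᶜ ∧ U v ≤ U x + a} x z τ ∧ U z ≤ l := by
    intro k l hl
    induction k with
    | zero =>
      intro x hx h1 h2 h3
      obtain ⟨τ, z, h4, h5, h6, h7⟩ := hstep x ⟨subset_closure hx, hl.trans h1, h2⟩
      refine ⟨τ, z, h4, ?_, h6, ?_⟩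
      · simpa using h5.trans (le_abs_self _)
      · simp only [Nat.cast_zero, zero_mul, add_zero] at h3; linarith
    | succ k ih =>
      intro x hx h1 h2 h3
      obtain ⟨τ, z, h4, h5, h6, h7⟩ := hstep x ⟨subset_closure hx, hl.trans h1, h2⟩
      have h5' := h5.trans (le_abs_self Θ)
      have hkΘ : 0 ≤ ((k : ℝ) + 1) * |Θ| := by positivity
      rcases le_or_gt (U z) l with hz | hz
      · refine ⟨τ, z, h4, ?_, h6, hz⟩
        push_cast; linarith
      · obtain ⟨σ, w, g1, g2, g3, g4⟩ := ih z (h6.end_mem h4.le).1 hz.le (by linarith)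
          (by push_cast at h3; linarith)
        refine ⟨τ + σ, w, by linarith, by push_cast; linarith, h6.trans h4.le g1.le
          (g3.mono fun v hv => ⟨hv.1, by linarith [hv.2]⟩), g4⟩
  obtain ⟨N, hN⟩ := exists_nat_ge (b / η)
  rw [div_le_iff₀ hη] at hN
  refine ⟨(N + 1) * |Θ|, fun x hx h1 h2 => ?_⟩
  obtain ⟨τ, z, g1, g2, g3, g4⟩ := key N (U x / 2) (by linarith) x hx (by linarith) h2
    (by linarith)
  exact ⟨τ, z, g1, g2, g3.mono fun v hv => ⟨hv.1, by linarith [hv.2]⟩, g4⟩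

/-- A halving strategy whose times are bounded on each shell. -/
theorem exists_halving_strategy (hT : IsClosed T) (hTne : T.Nonempty)
    (hf : ∀ Ω : Set (State n), IsOpen Ω → Bornology.IsBounded Ω → ∀ i, IsCb01On (f i) (Ω \ T))
    (hU : IsDegreeTwoCLF f T U) :
    ∃ (Z : State n → State n) (τ : State n → ℝ),
      (∀ x ∈ Tᶜ, 0 < τ x ∧ Steers f {v | v ∈ Tᶜ ∧ U v ≤ 2 * U x} x (Z x) (τ x) ∧
        U (Z x) ≤ U x / 2) ∧
      ∀ a b : ℝ, 0 < a → ∃ Θ : ℝ, ∀ x ∈ Tᶜ, a ≤ U x → U x ≤ b → τ x ≤ Θ := by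
  -- The strategy must not depend on the shell. Choosing a halving time within 1 of the infimum
  -- makes it nearly as fast as any shell-dependent bound.
  let A : State n → Set ℝ := fun x => {τ | 0 < τ ∧ ∃ z,
    Steers f {v | v ∈ Tᶜ ∧ U v ≤ 2 * U x} x z τ ∧ U z ≤ U x / 2}
  have hbdd : ∀ x, BddBelow (A x) := fun x => ⟨0, fun τ hτ => hτ.1.le⟩
  have hne : ∀ x ∈ Tᶜ, (A x).Nonempty := by
    intro x hx
    obtain ⟨Θ, h⟩ := hU.exists_halving hT hTne hf (b := U x) (hU.pos x hx)
    obtain ⟨τ, z, h1, -, h2, h3⟩ := h x hx le_rfl le_rfl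
    exact ⟨τ, h1, z, h2, h3⟩
  have hch : ∀ x, ∃ (z : State n) (τ : ℝ), x ∈ Tᶜ → (0 < τ ∧
      Steers f {v | v ∈ Tᶜ ∧ U v ≤ 2 * U x} x z τ ∧ U z ≤ U x / 2) ∧ τ < sInf (A x) + 1 := by
    intro x
    by_cases hx : x ∈ Tᶜ
    · obtain ⟨τ, ⟨h1, z, h2, h3⟩, h4⟩ := exists_lt_of_csInf_lt (hne x hx)
        (lt_add_one (sInf (A x)))
      exact ⟨z, τ, fun _ => ⟨⟨h1, h2, h3⟩, h4⟩⟩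
    · exact ⟨0, 0, fun h => absurd h hx⟩
  choose Z τ hZ using hch
  refine ⟨Z, τ, fun x hx => (hZ x hx).1, fun a b ha => ?_⟩
  obtain ⟨Θ, h⟩ := hU.exists_halving hT hTne hf (b := b) ha
  refine ⟨Θ + 1, fun x hx h1 h2 => ?_⟩
  obtain ⟨σ, z, g1, g2, g3, g4⟩ := h x hx h1 h2
  have : sInf (A x) ≤ σ := csInf_le (hbdd x) ⟨g1, z, g3, g4⟩
  linarith [(hZ x hx).2]

/-- Small values of the function force small distance to the target. -/
theorem exists_infDist_le_of_le (hU : IsDegreeTwoCLF f T U) {ε : ℝ}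
    (hε : 0 < ε) : ∃ b > 0, ∀ x ∈ Tᶜ, U x ≤ b → Metric.infDist x T ≤ ε := by
  have hc : IsCompact ((closure Tᶜ ∩ U ⁻¹' Icc 0 1) ∩ {x | ε ≤ Metric.infDist x T}) :=
    (hU.proper _ (fun r hr => hr.1) isCompact_Icc).inter_right
      (isClosed_le continuous_const (Metric.continuous_infDist_pt T))
  have hpos : ∀ x ∈ (closure Tᶜ ∩ U ⁻¹' Icc 0 1) ∩ {x | ε ≤ Metric.infDist x T}, 0 < U x := by
    intro x hx
    refine hU.pos x fun hxT => ?_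
    have : ε ≤ Metric.infDist x T := hx.2
    rw [Metric.infDist_zero_of_mem hxT] at this
    linarith
  rcases ((closure Tᶜ ∩ U ⁻¹' Icc 0 1) ∩ {x | ε ≤ Metric.infDist x T}).eq_empty_or_nonempty
    with he | hne
  · refine ⟨1, one_pos, fun x hx hx1 => ?_⟩
    by_contra hlt
    have : x ∈ (closure Tᶜ ∩ U ⁻¹' Icc 0 1) ∩ {x | ε ≤ Metric.infDist x T} :=
      ⟨⟨subset_closure hx, (hU.pos x hx).le, hx1⟩, (not_le.1 hlt).le⟩
    rw [he] at this
    exact this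
  · obtain ⟨z, hz, hmin⟩ := hc.exists_isMinOn hne
      (hU.continuousOn.mono (inter_subset_left.trans inter_subset_left))
    refine ⟨min 1 (U z / 2), lt_min one_pos (half_pos (hpos z hz)), fun x hx hxb => ?_⟩
    by_contra hlt
    have h1 := hmin (a := x) ⟨⟨subset_closure hx, (hU.pos x hx).le, hxb.trans (min_le_left _ _)⟩,
      (not_le.1 hlt).le⟩
    have h1' : U z ≤ U x := h1
    linarith [hxb.trans (min_le_right _ _), hpos z hz]

/-- Bounded values of the function force bounded distance to the target. -/
theorem exists_infDist_le (hU : IsDegreeTwoCLF f T U) (b : ℝ) :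
    ∃ R, ∀ x ∈ Tᶜ, U x ≤ b → Metric.infDist x T ≤ R := by
  obtain ⟨R, hR⟩ := (hU.proper (Icc 0 b) (fun r hr => hr.1)
    isCompact_Icc).exists_bound_of_continuousOn (Metric.continuous_infDist_pt T).continuousOn
  exact ⟨R, fun x hx hb => (le_abs_self _).trans
    (hR x ⟨subset_closure hx, (hU.pos x hx).le, hb⟩)⟩

end IsDegreeTwoCLF

/-- A point outside a closed set is at least as close to the frontier as to the set. -/
theorem exists_mem_frontier_dist_le (hT : IsClosed T) (hTne : T.Nonempty) {x : State n}
    (hx : x ∈ Tᶜ) : ∃ q ∈ frontier T, dist x q ≤ Metric.infDist x T := by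
  obtain ⟨z, hz, hd⟩ := hT.exists_infDist_eq_dist hTne x
  refine ⟨z, ⟨subset_closure hz, fun hint => ?_⟩, hd.ge⟩
  have hxz : 0 < dist x z := dist_pos.2 fun h => hx (h ▸ hz)
  -- Were the nearest point `z` interior, moving slightly towards `x` would stay in `T` and come
  -- closer.
  have hlim : Tendsto (fun s : ℝ => z + s • (x - z)) (𝓝[>] 0) (𝓝 z) := by
    have : Tendsto (fun s : ℝ => z + s • (x - z)) (𝓝 0) (𝓝 (z + (0:ℝ) • (x - z))) :=
      (by fun_prop : Continuous fun s : ℝ => z + s • (x - z)).tendsto 0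
    rw [zero_smul, add_zero] at this
    exact this.mono_left nhdsWithin_le_nhds
  obtain ⟨s, ⟨hs1, hs0⟩, hs2⟩ := (((hlim.eventually
    (isOpen_interior.mem_nhds hint)).and eventually_mem_nhdsWithin).and
    (nhdsWithin_le_nhds (gt_mem_nhds one_pos))).exists
  have h1 := Metric.infDist_le_dist_of_mem (x := x) (interior_subset hs1)
  have e : x - (z + s • (x - z)) = (1 - s) • (x - z) := by rw [sub_smul, one_smul]; abel
  have hs0' : (0:ℝ) < s := hs0
  have hs2' : s < 1 := hs2
  rw [hd, dist_eq_norm x (z + s • (x - z)), e, norm_smul, Real.norm_of_nonneg (by linarith),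
    ← dist_eq_norm] at h1
  nlinarith

/-- This is where compactness of the boundary enters: points outside `T` and close to it are equally
close to its frontier, hence bounded. -/
theorem isCompact_infDist_le (hT : IsClosed T) (hTne : T.Nonempty)
    (hT_frontier : IsCompact (frontier T)) (R : ℝ) :
    IsCompact {x | x ∈ closure Tᶜ ∧ Metric.infDist x T ≤ R} := by
  refine Metric.isCompact_of_isClosed_isBounded
    (isClosed_closure.inter (isClosed_le (Metric.continuous_infDist_pt T) continuous_const)) ?_
  refine (hT_frontier.isBounded.cthickening (δ := R)).subset fun x hx => ?_
  by_cases hxT : x ∈ Tᶜ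
  · obtain ⟨q, hq, hd⟩ := exists_mem_frontier_dist_le hT hTne hxT
    exact Metric.mem_cthickening_of_dist_le x q R _ hq (hd.trans hx.2)
  · refine Metric.self_subset_cthickening _ ?_
    rw [frontier_eq_closure_inter_closure]
    exact ⟨subset_closure (not_not.1 hxT), hx.1⟩

namespace IsDegreeTwoCLF

/-- Bounded distance to the target forces bounded values of the function. -/
theorem exists_le_of_infDist_le (hT : IsClosed T) (hTne : T.Nonempty)
    (hT_frontier : IsCompact (frontier T)) (hU : IsDegreeTwoCLF f T U) (R : ℝ) :
    ∃ b, ∀ x ∈ Tᶜ, Metric.infDist x T ≤ R → U x ≤ b := by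
  obtain ⟨b, hb⟩ := (isCompact_infDist_le hT hTne hT_frontier R).exists_bound_of_continuousOn
    (hU.continuousOn.mono fun x hx => hx.1)
  exact ⟨b, fun x hx hR => (le_abs_self _).trans (hb x ⟨subset_closure hx, hR⟩)⟩

/-- Small distance to the target forces small values of the function. -/
theorem exists_le_of_infDist_le' (hT : IsClosed T) (hTne : T.Nonempty)
    (hT_frontier : IsCompact (frontier T)) (hU : IsDegreeTwoCLF f T U) {b : ℝ} (hb : 0 < b) :
    ∃ δ > 0, ∀ x ∈ Tᶜ, Metric.infDist x T ≤ δ → U x ≤ b := by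
  set C := {x | x ∈ closure Tᶜ ∧ Metric.infDist x T ≤ 1} with hC
  have hCc : IsCompact C := isCompact_infDist_le hT hTne hT_frontier 1
  have hc : IsCompact (C ∩ U ⁻¹' Ici b) := by
    refine hCc.of_isClosed_subset ?_ inter_subset_left
    exact (hU.continuousOn.mono fun x hx => hx.1).preimage_isClosed_of_isClosed hCc.isClosed
      isClosed_Ici
  have hpos : ∀ x ∈ C ∩ U ⁻¹' Ici b, 0 < Metric.infDist x T := fun x hx =>
    (hT.notMem_iff_infDist_pos hTne).1 (hU.mem_compl hx.1.1 (hb.trans_le hx.2))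
  rcases (C ∩ U ⁻¹' Ici b).eq_empty_or_nonempty with he | hne
  · refine ⟨1, one_pos, fun x hx hx1 => ?_⟩
    by_contra hlt
    have : x ∈ C ∩ U ⁻¹' Ici b := ⟨⟨subset_closure hx, hx1⟩, (not_le.1 hlt).le⟩
    rw [he] at this
    exact this
  · obtain ⟨z, hz, hmin⟩ := hc.exists_isMinOn hne (Metric.continuous_infDist_pt T).continuousOn
    refine ⟨min 1 (Metric.infDist z T / 2), lt_min one_pos (half_pos (hpos z hz)),
      fun x hx hxb => ?_⟩
    by_contra hlt
    have h1 : Metric.infDist z T ≤ Metric.infDist x T :=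
      hmin (a := x) ⟨⟨subset_closure hx, hxb.trans (min_le_left _ _)⟩, (not_le.1 hlt).le⟩
    linarith [hxb.trans (min_le_right _ _), hpos z hz]

end IsDegreeTwoCLF

end LieCLF

/-! ### The trajectory generated by a halving strategy -/

namespace LieCLF

variable {n m : ℕ} {T : Set (State n)} {f : Fin m → State n → State n} {U : State n → ℝ}

/-- Following a halving strategy gives an admissible trajectory along which the function decays
within times controlled by the strategy. -/
theorem IsDegreeTwoCLF.exists_trajectory (hT : IsClosed T) (hTne : T.Nonempty)
    (hf : ∀ i, ContinuousOn (f i) Tᶜ) (hU : IsDegreeTwoCLF f T U)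
    {Z : State n → State n} {τ : State n → ℝ}
    (hZ : ∀ x ∈ Tᶜ, 0 < τ x ∧ Steers f {v | v ∈ Tᶜ ∧ U v ≤ 2 * U x} x (Z x) (τ x) ∧
        U (Z x) ≤ U x / 2) {x : State n} (hx : x ∈ Tᶜ) :
    ∃ (y : ℝ → State n) (α : ℝ → Fin m → ℝ) (S : EReal), IsAdmissible f T x y α S ∧
      (∃ xbar ∈ frontier T, ∀ t : ℝ, S ≤ (t : EReal) → y t = xbar) ∧
      (∀ t : ℝ, 0 ≤ t → y t ∈ T ∨ y t ∈ Tᶜ ∧ U (y t) ≤ 2 * U x) ∧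
      ∀ (a b Θ : ℝ) (N : ℕ), 0 ≤ Θ → (∀ z ∈ Tᶜ, a ≤ U z → U z ≤ b → τ z ≤ Θ) → U x ≤ b →
        b / 2 ^ N ≤ a → ∀ t : ℝ, 0 ≤ t → N * Θ ≤ t → y t ∈ T ∨ y t ∈ Tᶜ ∧ U (y t) ≤ 2 * a := by
  obtain ⟨xbar, hxbar, -⟩ := exists_mem_frontier_dist_le hT hTne hx
  have hxbarT : xbar ∈ T := hT.frontier_subset hxbar
  set X : ℕ → State n := fun k => Z^[k] x with hX
  have hXs : ∀ k, X (k + 1) = Z (X k) := fun k => Function.iterate_succ_apply' Z k x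
  have hXT : ∀ k, X k ∈ Tᶜ := by
    intro k
    induction k with
    | zero => exact hx
    | succ k ih =>
      rw [hXs]
      exact ((hZ _ ih).2.1.end_mem (hZ _ ih).1.le).1
  have hhalf : ∀ k, U (X (k + 1)) ≤ U (X k) / 2 := fun k => by
    rw [hXs]; exact (hZ _ (hXT k)).2.2
  have hanti : Antitone fun k => U (X k) := antitone_nat_of_succ_le fun k => by
    linarith [hhalf k, hU.pos _ (hXT k)]
  have hgeo : ∀ k, U (X k) ≤ U x / 2 ^ k := by
    intro k
    induction k with
    | zero => simp [hX]
    | succ k ih =>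
      refine (hhalf k).trans ?_
      rw [pow_succ, ← div_div]
      linarith
  obtain ⟨y, α, hy0, hαm, hαA, hyS, hyc, hyd⟩ := exists_glue
    (fun k => {v | v ∈ Tᶜ ∧ U v ≤ 2 * U (X k)}) X (fun k => τ (X k))
    (fun k => (hZ _ (hXT k)).1) (fun k => by rw [hXs]; exact (hZ _ (hXT k)).2.1) xbar
  set s : ℕ → ℝ := fun k => ∑ j ∈ Finset.range k, τ (X j) with hs
  have hs0 : s 0 = 0 := by simp [hs]
  have hss : ∀ k, s (k + 1) = s k + τ (X k) := fun k => Finset.sum_range_succ _ _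
  have hsm : StrictMono s := strictMono_nat_of_lt_succ fun k => by
    rw [hss]; linarith [(hZ _ (hXT k)).1]
  -- The total time may be finite or infinite; in the finite case the glued curve rests at `xbar`
  -- from `S` on.
  set S : EReal := ⨆ k, (s k : EReal) with hS
  have hlt : ∀ t : ℝ, (t : EReal) < S ↔ ∃ k, t < s k := fun t => by
    rw [hS, lt_iSup_iff]
    simp only [EReal.coe_lt_coe_iff]
  have hpiece : ∀ t : ℝ, 0 ≤ t → (t : EReal) < S → ∃ k, s k ≤ t ∧ t < s (k + 1) := by
    classical
    intro t ht htS
    have hex := (hlt t).1 htS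
    have hk := Nat.find_spec hex
    obtain ⟨k, hk'⟩ : ∃ k, Nat.find hex = k + 1 := by
      refine Nat.exists_eq_succ_of_ne_zero fun h => ?_
      rw [h, hs0] at hk
      linarith
    refine ⟨k, ?_, by rwa [hk'] at hk⟩
    exact not_lt.1 (Nat.find_min hex (by omega))
  have hafter : ∀ t : ℝ, ¬ (t : EReal) < S → y t = xbar := fun t ht => hyS t fun k => by
    by_contra hcon
    exact ht ((hlt t).2 ⟨k, not_le.1 hcon⟩)
  have hbound : ∀ j, ∀ t : ℝ, 0 ≤ t → s j ≤ t → (t : EReal) < S →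
      y t ∈ Tᶜ ∧ U (y t) ≤ 2 * U (X j) := by
    intro j t ht hjt htS
    obtain ⟨k, hk1, hk2⟩ := hpiece t ht htS
    have hjk : j ≤ k := Nat.lt_succ_iff.1 (hsm.lt_iff_lt.1 (hjt.trans_lt hk2))
    have h := (hyd k t hk1 hk2).1
    have h' := hanti hjk
    exact ⟨h.1, h.2.trans (by simp only at h'; linarith)⟩
  have hsnn : ∀ k, 0 ≤ s k := fun k => by rw [← hs0]; exact hsm.monotone k.zero_le
  have hlim : ∀ ε > 0, ∃ k, ∀ t : ℝ, s k ≤ t → (t : EReal) < S → Metric.infDist (y t) T < ε := by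
    intro ε hε
    obtain ⟨b, hb, h⟩ := hU.exists_infDist_le_of_le (half_pos hε)
    obtain ⟨k, hk⟩ := pow_unbounded_of_one_lt (2 * U x / b) (one_lt_two : (1:ℝ) < 2)
    refine ⟨k, fun t hkt htS => ?_⟩
    obtain ⟨h1, h2⟩ := hbound k t ((hsnn k).trans hkt) hkt htS
    have h3 : 2 * U (X k) ≤ b := by
      have h4 := hgeo k
      rw [le_div_iff₀ (by positivity)] at h4
      rw [div_lt_iff₀ hb] at hk
      have h2k : (0:ℝ) < 2 ^ k := by positivity
      nlinarith
    linarith [h _ h1 (h2.trans h3)]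
  have hdist : ∀ t, dist (Metric.infDist (y t) T) 0 = Metric.infDist (y t) T := fun t => by
    rw [Real.dist_eq, sub_zero, abs_of_nonneg Metric.infDist_nonneg]
  refine ⟨y, α, S, ⟨hαm, fun t _ => hαA t, ?_, ?_, ?_⟩, ⟨xbar, hxbar, fun t ht => hafter t
    (not_lt.2 ht)⟩, ?_, ?_⟩
  · refine isSolution_of_hasDerivWithinAt hf ?_ hy0 hαm hαA ?_ ?_ ?_
    · have := (hlt 0).2 ⟨1, by rw [← hs0]; exact hsm zero_lt_one⟩
      simpa using this
    · intro t ht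
      obtain ⟨k, hk⟩ := (hlt t).1 ht.2
      refine (hyc k t ⟨ht.1, hk.le⟩).mono_of_mem_nhdsWithin ?_
      filter_upwards [mem_nhdsWithin_of_mem_nhds (Iio_mem_nhds hk), self_mem_nhdsWithin]
        with r hr hr'
      exact ⟨hr'.1, le_of_lt hr⟩
    · intro t ht htS
      exact (hbound 0 t ht (by rwa [hs0]) htS).1
    · intro t ht htS
      obtain ⟨k, hk1, hk2⟩ := hpiece t ht htS
      exact (hyd k t hk1 hk2).2
  · intro hST
    rw [Metric.tendsto_nhds]
    intro ε hε
    obtain ⟨k, hk⟩ := hlim ε hε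
    filter_upwards [eventually_ge_atTop (s k)] with t ht
    rw [hdist]
    exact hk t ht (by rw [hST]; exact EReal.coe_lt_top t)
  · intro r hSr
    rw [Metric.tendsto_nhds]
    intro ε hε
    obtain ⟨k, hk⟩ := hlim ε hε
    have hkr : s k < r := by
      have := (hlt (s k)).2 ⟨k + 1, hsm k.lt_succ_self⟩
      rwa [hSr, EReal.coe_lt_coe_iff] at this
    filter_upwards [Ioo_mem_nhdsLT hkr] with t ht
    rw [hdist]
    exact hk t ht.1.le (by rw [hSr, EReal.coe_lt_coe_iff]; exact ht.2)
  · intro t ht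
    by_cases htS : (t : EReal) < S
    · exact Or.inr (hbound 0 t ht (by rwa [hs0]) htS)
    · rw [hafter t htS]; exact Or.inl hxbarT
  · intro a b Θ N hΘ hτ hxb hN t ht hNt
    by_cases htS : (t : EReal) < S
    -- Either a node below level `a` was reached by time `N * Θ`, or each of the first `N` legs
    -- began in the shell and took at most `Θ`. In the second case `N` halvings bring `U` below `b /
    -- 2 ^ N ≤ a`.
    · have key : ∀ N : ℕ, (∃ j, U (X j) ≤ a ∧ s j ≤ N * Θ) ∨ s N ≤ N * Θ := by
        intro N
        induction N with
        | zero => exact Or.inr (by simp [hs0])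
        | succ N ih =>
          rcases ih with ⟨j, h1, h2⟩ | h
          · exact Or.inl ⟨j, h1, by push_cast; linarith⟩
          · rcases le_or_gt (U (X N)) a with h1 | h1
            · exact Or.inl ⟨N, h1, by push_cast; linarith⟩
            · refine Or.inr ?_
              have := hτ _ (hXT N) h1.le ((hanti N.zero_le).trans hxb)
              rw [hss]; push_cast; linarith
      obtain ⟨j, h1, h2⟩ : ∃ j, U (X j) ≤ a ∧ s j ≤ N * Θ := by
        rcases key N with h | h
        · exact h
        · refine ⟨N, (hgeo N).trans (le_trans ?_ hN), h⟩
          gcongr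
      obtain ⟨h3, h4⟩ := hbound j t ht (h2.trans hNt) htS
      exact Or.inr ⟨h3, by linarith⟩
    · rw [hafter t htS]; exact Or.inl hxbarT

theorem continuousOn_compl_of_isCb01On (hT : IsClosed T)
    (hf : ∀ Ω : Set (State n), IsOpen Ω → Bornology.IsBounded Ω → ∀ i, IsCb01On (f i) (Ω \ T))
    (i : Fin m) : ContinuousOn (f i) Tᶜ := by
  intro x hx
  obtain ⟨-, K, hK⟩ := hf (Metric.ball x 1) Metric.isOpen_ball Metric.isBounded_ball i
  refine (hK.continuousOn.continuousAt ?_).continuousWithinAt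
  exact inter_mem (Metric.ball_mem_nhds x one_pos) (hT.isOpen_compl.mem_nhds hx)

end LieCLF

/-! ### Conclusion -/

theorem theorem4p1 (n m : ℕ) (T : Set (LieCLF.State n))
    (hT_closed : IsClosed T) (hT_nonempty : T.Nonempty) (hT_frontier : IsCompact (frontier T))
    (f : Fin m → LieCLF.State n → LieCLF.State n)
    (hf : ∀ Ω : Set (LieCLF.State n), IsOpen Ω → Bornology.IsBounded Ω →
      ∀ i, LieCLF.IsCb01On (f i) (Ω \ T))
    (hU : ∃ U : LieCLF.State n → ℝ, LieCLF.IsDegreeTwoCLF f T U) :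
    LieCLF.IsGAC f T := by
  obtain ⟨U, hU⟩ := hU
  obtain ⟨Z, τ, hZ, hτ⟩ := hU.exists_halving_strategy hT_closed hT_nonempty hf
  have htraj := fun x : {x // x ∈ Tᶜ} => hU.exists_trajectory hT_closed hT_nonempty
    (LieCLF.continuousOn_compl_of_isCb01On hT_closed hf) hZ x.2
  choose y α S hadm hbar hstab hattr using htraj
  have hle : ∀ {ε b : ℝ}, 0 ≤ ε → (∀ z ∈ Tᶜ, U z ≤ b → Metric.infDist z T ≤ ε) →
      ∀ z, (z ∈ T ∨ z ∈ Tᶜ ∧ U z ≤ b) → Metric.infDist z T ≤ ε := by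
    rintro ε b hε h z (hz | hz)
    · rw [Metric.infDist_zero_of_mem hz]; exact hε
    · exact h z hz.1 hz.2
  obtain ⟨β, hβ, hβD⟩ := LieCLF.exists_isKL_of_uniform
    (fun x : {x // x ∈ Tᶜ} => Metric.infDist x.1 T) (fun x t => Metric.infDist (y x t) T)
    (fun x => (hT_closed.notMem_iff_infDist_pos hT_nonempty).1 x.2)
    (fun x t _ => Metric.infDist_nonneg)
    (by
      intro ε hε
      obtain ⟨b, hb, h1⟩ := hU.exists_infDist_le_of_le hε
      obtain ⟨δ, hδ, h2⟩ := hU.exists_le_of_infDist_le' hT_closed hT_nonempty hT_frontier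
        (half_pos hb)
      refine ⟨δ, hδ, fun x hx t ht => hle hε.le h1 _ ((hstab x t ht).imp_right fun h =>
        ⟨h.1, h.2.trans ?_⟩)⟩
      linarith [h2 x.1 x.2 hx])
    (by
      intro R
      obtain ⟨b, hb⟩ := hU.exists_le_of_infDist_le hT_closed hT_nonempty hT_frontier R
      obtain ⟨M, hM⟩ := hU.exists_infDist_le (2 * b)
      refine ⟨max M 0, fun x hx t ht => hle (le_max_right _ _)
        (fun z hz hzb => (hM z hz hzb).trans (le_max_left _ _)) _
        ((hstab x t ht).imp_right fun h => ⟨h.1, h.2.trans ?_⟩)⟩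
      linarith [hb x.1 x.2 hx])
    (by
      intro R ε hε
      obtain ⟨b, hb⟩ := hU.exists_le_of_infDist_le hT_closed hT_nonempty hT_frontier R
      obtain ⟨c, hc, h1⟩ := hU.exists_infDist_le_of_le hε
      -- The level is `c / 2` because the overshoot may double it.
      obtain ⟨Θ, hΘ⟩ := hτ (c / 2) b (half_pos hc)
      obtain ⟨N, hN⟩ := pow_unbounded_of_one_lt (b / (c / 2)) (one_lt_two : (1:ℝ) < 2)
      refine ⟨N * |Θ|, fun x hx t ht hNt => hle hε.le h1 _ ((hattr x (c / 2) b |Θ| N (abs_nonneg _)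
        (fun z hz h2 h3 => (hΘ z hz h2 h3).trans (le_abs_self _)) (hb x.1 x.2 hx) ?_ t ht
        hNt).imp_right fun h => ⟨h.1, h.2.trans (by linarith)⟩)⟩
      rw [div_lt_iff₀ (half_pos hc)] at hN
      rw [div_le_iff₀ (by positivity)]
      linarith)
  exact ⟨β, hβ, fun x hx => ⟨y ⟨x, hx⟩, α ⟨x, hx⟩, S ⟨x, hx⟩, hadm ⟨x, hx⟩, hbar ⟨x, hx⟩,
    fun t ht => hβD ⟨x, hx⟩ t ht⟩⟩
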